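/- For $m\ge 1$ let $\mathcal D_{\mathbb C^m}$ be the sheaf of linear differential operators with holomorphic coefficients on $\mathbb C^m$. For an integer row matrix $B=(b_1\ \cdots\ b_m)$ and $\beta\in\mathbb C$, let $H_B(\beta)$ be the left ideal of the Weyl algebra $\mathbb C[x_1,\dots,x_m]\langle\partial_1,\dots,\partial_m\rangle$ generated by the operators $\partial^{u_+}-\partial^{u_-}$ for $u\in\mathbb Z^m$ with $\sum_i b_iu_i=0$ (where $u=u_+-u_-$ with $u_+,u_-\in\mathbb N^m$ of disjoint supports) and by the Euler operator $\sum_i b_ix_i\partial_i-\beta$, and let $\mathcal M_B(\beta)=\mathcal D_{\mathbb C^m}/\mathcal D_{\mathbb C^m}H_B(\beta)$. **Theorem.** Let $1<a_1<\cdots<a_n$ be integers with $\gcd(a_1,\dots,a_n)=1$, let $A=(a_1\ \cdots\ a_n)$ and $A'=(1\ a_1\ \cdots\ a_n)$, and let $X'=\mathbb C^{n+1}$ with coordinates $x_0,x_1,\dots,x_n$ and $X=\{x_0=0\}\cong\mathbb C^n$. Then for each $\beta\in\mathbb C$ there exists $\beta'\in\mathbb C$ such that the restriction of $\mathcal M_{A'}(\beta)$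 to $X$, that is, the sheaf of left $\mathcal D_X$-modules $$\frac{\mathcal D_{X'}}{\mathcal D_{X'}H_{A'}(\beta)+x_0\mathcal D_{X'}}$$ (which is supported on $X$, and on which $\mathcal D_X$ acts by left multiplication by operators not involving $x_0$ and $\partial_0$), is isomorphic to $\mathcal M_A(\beta')$ as a sheaf of left $\mathcal D_X$-modules. Moreover, $\beta'$ can be chosen so that $\beta'=\beta$ for all but finitely many $\beta\in\mathbb C$. -/

import Mathlib

open Filter Topology CategoryTheory TopologicalSpace

noncomputable section

namespace HolD

/-- The space of germs at `p` of holomorphic functions on `ℂⁿ`, inside all germs of functions. -/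
def holGerms {n : ℕ} (p : Fin n → ℂ) : Submodule ℂ (Germ (𝓝 p) ℂ) where
  carrier := {g | ∃ f : (Fin n → ℂ) → ℂ, AnalyticAt ℂ f p ∧ (f : Germ (𝓝 p) ℂ) = g}
  add_mem' := by
    rintro _ _ ⟨f, hf, rfl⟩ ⟨g, hg, rfl⟩
    exact ⟨f + g, hf.add hg, rfl⟩
  zero_mem' := ⟨0, analyticAt_const, rfl⟩
  smul_mem' := by
    rintro c _ ⟨f, hf, rfl⟩
    exact ⟨c • f, analyticAt_const.smul hf, rfl⟩

/-- The stalk `𝒪_p` of germs at `p` of holomorphic functions on `ℂⁿ`. -/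
def HolGerm {n : ℕ} (p : Fin n → ℂ) : Type := holGerms p

instance {n : ℕ} (p : Fin n → ℂ) : AddCommGroup (HolGerm p) :=
  inferInstanceAs (AddCommGroup (holGerms p))

instance {n : ℕ} (p : Fin n → ℂ) : Module ℂ (HolGerm p) :=
  inferInstanceAs (Module ℂ (holGerms p))

/-- The germ at `p` of a function holomorphic at `p`. -/
def holGerm {n : ℕ} {p : Fin n → ℂ} (f : (Fin n → ℂ) → ℂ) (hf : AnalyticAt ℂ f p) : HolGerm p :=
  ⟨(f : Germ (𝓝 p) ℂ), f, hf, rfl⟩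

/-- Every holomorphic germ is the germ of a holomorphic function. -/
theorem HolGerm.ind {n : ℕ} {p : Fin n → ℂ} {motive : HolGerm p → Prop}
    (h : ∀ f hf, motive (holGerm f hf)) (g : HolGerm p) : motive g := by
  obtain ⟨_, f, hf, rfl⟩ := g
  exact h f hf

theorem holGerm_eq_iff {n : ℕ} {p : Fin n → ℂ} {f g : (Fin n → ℂ) → ℂ} {hf : AnalyticAt ℂ f p}
    {hg : AnalyticAt ℂ g p} : holGerm f hf = holGerm g hg ↔ f =ᶠ[𝓝 p] g := by
  rw [← Germ.coe_eq]
  exact Subtype.ext_iff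

/-- Multiplication by a function holomorphic at `p`, as an operator on `𝒪_p`. -/
def mulOp {n : ℕ} {p : Fin n → ℂ} (f : (Fin n → ℂ) → ℂ) (hf : AnalyticAt ℂ f p) :
    Module.End ℂ (HolGerm p) where
  toFun g := ⟨(f : Germ (𝓝 p) ℂ) * g.1, by
    obtain ⟨_, g, hg, rfl⟩ := g
    exact ⟨f * g, hf.mul hg, rfl⟩⟩
  map_add' g h := Subtype.ext (mul_add _ _ _)
  map_smul' c g := by
    induction g using HolGerm.ind with
    | h g hg =>
      exact Subtype.ext (Germ.coe_eq.2 (.of_forall fun x => mul_left_comm (f x) c (g x)))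

/-- The partial derivative `∂f/∂xᵢ` of a function on `ℂⁿ`. -/
def pderiv {n : ℕ} (i : Fin n) (f : (Fin n → ℂ) → ℂ) : (Fin n → ℂ) → ℂ :=
  fun x => fderiv ℂ f x (Pi.single i 1)

theorem analyticAt_pderiv {n : ℕ} (i : Fin n) {f : (Fin n → ℂ) → ℂ} {p : Fin n → ℂ}
    (hf : AnalyticAt ℂ f p) : AnalyticAt ℂ (pderiv i f) p :=
  ((ContinuousLinearMap.apply ℂ ℂ (Pi.single i 1 : Fin n → ℂ)).analyticAt _).comp hf.fderiv

theorem pderiv_congr {n : ℕ} (i : Fin n) {f g : (Fin n → ℂ) → ℂ} {p : Fin n → ℂ}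
    (h : f =ᶠ[𝓝 p] g) : pderiv i f =ᶠ[𝓝 p] pderiv i g := by
  filter_upwards [h.fderiv (𝕜 := ℂ)] with x hx
  simp only [pderiv, hx]

/-- The partial derivative `∂ᵢ`, as an operator on `𝒪_p`. -/
def partialOp {n : ℕ} {p : Fin n → ℂ} (i : Fin n) : Module.End ℂ (HolGerm p) where
  toFun g := ⟨Germ.map' (pderiv i)
      (fun _ _ h => pderiv_congr i h) g.1, by
    obtain ⟨_, g, hg, rfl⟩ := g
    exact ⟨pderiv i g, analyticAt_pderiv i hg, rfl⟩⟩
  map_add' g h := by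
    induction g using HolGerm.ind with
    | h g hg =>
      induction h using HolGerm.ind with
      | h h hh =>
        refine holGerm_eq_iff (hf := analyticAt_pderiv i (hg.add hh))
          (hg := (analyticAt_pderiv i hg).add (analyticAt_pderiv i hh)).2 ?_
        filter_upwards [hg.eventually_analyticAt, hh.eventually_analyticAt] with x hgx hhx
        simp [pderiv, fderiv_add hgx.differentiableAt hhx.differentiableAt]
  map_smul' c g := by
    induction g using HolGerm.ind with
    | h g hg =>
      refine holGerm_eq_iff (hf := analyticAt_pderiv i ((analyticAt_const (v := c)).smul hg))
          (hg := (analyticAt_const (v := c)).smul (analyticAt_pderiv i hg)).2 ?_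
      filter_upwards [hg.eventually_analyticAt] with x hgx
      change fderiv ℂ (c • g) x (Pi.single i 1) = c • fderiv ℂ g x (Pi.single i 1)
      rw [fderiv_const_smul hgx.differentiableAt]
      rfl

theorem mulOp_holGerm {n : ℕ} {p : Fin n → ℂ} {f g : (Fin n → ℂ) → ℂ} (hf : AnalyticAt ℂ f p)
    (hg : AnalyticAt ℂ g p) : mulOp f hf (holGerm g hg) = holGerm (f * g) (hf.mul hg) := rfl

theorem partialOp_holGerm {n : ℕ} {p : Fin n → ℂ} {g : (Fin n → ℂ) → ℂ} (i : Fin n)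
    (hg : AnalyticAt ℂ g p) :
    partialOp i (holGerm g hg) = holGerm (pderiv i g) (analyticAt_pderiv i hg) := rfl

/-- The algebra of operators on `𝒪_p` generated by the holomorphic functions and the `∂ᵢ`. -/
def diffOps {n : ℕ} (p : Fin n → ℂ) : Subalgebra ℂ (Module.End ℂ (HolGerm p)) :=
  Algebra.adjoin ℂ ({T | ∃ f, ∃ hf : AnalyticAt ℂ f p, T = mulOp f hf} ∪ Set.range partialOp)

/-- The ring `𝒟_p` of germs at `p` of linear differential operators with holomorphic
coefficients. -/
def DStalk {n : ℕ} (p : Fin n → ℂ) : Type := diffOps p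

instance {n : ℕ} (p : Fin n → ℂ) : Ring (DStalk p) := inferInstanceAs (Ring (diffOps p))

instance {n : ℕ} (p : Fin n → ℂ) : Algebra ℂ (DStalk p) := inferInstanceAs (Algebra ℂ (diffOps p))

/-- A function holomorphic at `p`, as an element of `𝒟_p`. -/
def mulD {n : ℕ} {p : Fin n → ℂ} (f : (Fin n → ℂ) → ℂ) (hf : AnalyticAt ℂ f p) : DStalk p :=
  ⟨mulOp f hf, Algebra.subset_adjoin (Or.inl ⟨f, hf, rfl⟩)⟩

/-- `∂ᵢ` as an element of `𝒟_p`. -/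
def partialD {n : ℕ} {p : Fin n → ℂ} (i : Fin n) : DStalk p :=
  ⟨partialOp i, Algebra.subset_adjoin (Or.inr ⟨i, rfl⟩)⟩

theorem analyticAt_coord {n : ℕ} (i : Fin n) (p : Fin n → ℂ) :
    AnalyticAt ℂ (fun x : Fin n → ℂ => x i) p :=
  (ContinuousLinearMap.proj (R := ℂ) (φ := fun _ : Fin n => ℂ) i).analyticAt p

/-- The coordinate function `xᵢ` as an element of `𝒟_p`. -/
def coordD {n : ℕ} {p : Fin n → ℂ} (i : Fin n) : DStalk p :=
  mulD (fun x => x i) (analyticAt_coord i p)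

/-! ### The hyperplane `x₀ = 0` in `ℂⁿ⁺¹` and the extension of operators from it -/

/-- The inclusion `ℂⁿ → ℂⁿ⁺¹`, `x ↦ (0, x)`. -/
def incl {n : ℕ} (x : Fin n → ℂ) : Fin (n + 1) → ℂ := Fin.cons 0 x

/-- `f(x₁, …, xₙ)` regarded as a function of `(x₀, x₁, …, xₙ)`. -/
def pull {n : ℕ} (f : (Fin n → ℂ) → ℂ) : (Fin (n + 1) → ℂ) → ℂ := fun x => f (Fin.tail x)

def tailL (n : ℕ) : (Fin (n + 1) → ℂ) →L[ℂ] (Fin n → ℂ) :=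
  ContinuousLinearMap.pi fun i => ContinuousLinearMap.proj i.succ

def inclL (n : ℕ) : (Fin n → ℂ) →L[ℂ] (Fin (n + 1) → ℂ) :=
  ContinuousLinearMap.pi (Fin.cons 0 fun i => ContinuousLinearMap.proj i)

theorem inclL_apply {n : ℕ} (x : Fin n → ℂ) : inclL n x = incl x := by
  ext i
  refine Fin.cases ?_ (fun j => ?_) i <;> simp [inclL, incl]

theorem analyticAt_incl {n : ℕ} (p : Fin n → ℂ) : AnalyticAt ℂ (incl (n := n)) p :=
  ((inclL n).analyticAt p).congr (.of_forall inclL_apply)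

theorem continuous_incl {n : ℕ} : Continuous (incl (n := n)) :=
  continuous_iff_continuousAt.2 fun p => (analyticAt_incl p).continuousAt

theorem tail_incl {n : ℕ} (x : Fin n → ℂ) : Fin.tail (incl x) = x := Fin.tail_cons _ _

theorem analyticAt_pull {n : ℕ} {f : (Fin n → ℂ) → ℂ} {y : Fin (n + 1) → ℂ}
    (hf : AnalyticAt ℂ f (Fin.tail y)) : AnalyticAt ℂ (pull f) y :=
  AnalyticAt.comp (g := f) (f := tailL n) hf ((tailL n).analyticAt y)

theorem analyticAt_pull_incl {n : ℕ} {f : (Fin n → ℂ) → ℂ} {p : Fin n → ℂ}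
    (hf : AnalyticAt ℂ f p) : AnalyticAt ℂ (pull f) (incl p) :=
  analyticAt_pull (by rwa [tail_incl])

/-- The graph of the ring homomorphism `𝒟_{ℂⁿ,p} → 𝒟_{ℂⁿ⁺¹,(0,p)}` that regards an operator in
`x₁, …, xₙ` as an operator in `x₀, x₁, …, xₙ` not involving `x₀` and `∂₀`. -/
def liftGraph {n : ℕ} (p : Fin n → ℂ) : Subalgebra ℂ (DStalk (incl p) × DStalk p) :=
  Algebra.adjoin ℂ
    ({T | ∃ f, ∃ hf : AnalyticAt ℂ f p, T = (mulD (pull f) (analyticAt_pull_incl hf), mulD f hf)} ∪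
      Set.range fun i => (partialD i.succ, partialD i))

/-- Restriction of germs of holomorphic functions to the hyperplane. -/
def restrGerm {n : ℕ} (p : Fin n → ℂ) : HolGerm (incl p) →ₗ[ℂ] HolGerm p where
  toFun g := ⟨g.1.compTendsto incl continuous_incl.continuousAt, by
    obtain ⟨_, g, hg, rfl⟩ := g
    exact ⟨g ∘ incl, hg.comp (analyticAt_incl p), rfl⟩⟩
  map_add' g h := by
    obtain ⟨_, g, hg, rfl⟩ := g
    obtain ⟨_, h, hh, rfl⟩ := h
    rfl
  map_smul' c g := by
    obtain ⟨_, g, hg, rfl⟩ := g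
    rfl

theorem restrGerm_holGerm {n : ℕ} {p : Fin n → ℂ} {g : (Fin (n + 1) → ℂ) → ℂ}
    (hg : AnalyticAt ℂ g (incl p)) :
    restrGerm p (holGerm g hg) = holGerm (g ∘ incl) (hg.comp (analyticAt_incl p)) := rfl

theorem partialOp_mulOp_pull {n : ℕ} {p : Fin n → ℂ} {f : (Fin n → ℂ) → ℂ}
    (hf : AnalyticAt ℂ f p) :
    partialOp 0 * mulOp (pull f) (analyticAt_pull_incl hf) =
      mulOp (pull f) (analyticAt_pull_incl hf) * partialOp 0 := by
  ext1 g
  induction g using HolGerm.ind with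
  | h g hg =>
    refine holGerm_eq_iff (hf := analyticAt_pderiv 0 ((analyticAt_pull_incl hf).mul hg))
      (hg := (analyticAt_pull_incl hf).mul (analyticAt_pderiv 0 hg)).2 ?_
    filter_upwards [(analyticAt_pull_incl hf).eventually_analyticAt, hg.eventually_analyticAt,
      (tailL n).continuous.continuousAt.eventually
        (show ∀ᶠ x in 𝓝 (tailL n (incl p)), AnalyticAt ℂ f x from by
          rw [show tailL n (incl p) = p from tail_incl p]
          exact hf.eventually_analyticAt)] with x h1 h2 h3
    have h4 : fderiv ℂ (pull f) x = (fderiv ℂ f (tailL n x)).comp (tailL n) := by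
      have := fderiv_comp x (g := f) (f := tailL n) h3.differentiableAt
        (tailL n).differentiableAt
      rwa [(tailL n).fderiv] at this
    have h5 : tailL n (Pi.single 0 1) = 0 := by
      ext j
      simp [tailL]
    simp [pderiv, fderiv_mul h1.differentiableAt h2.differentiableAt, h4, h5]

theorem partialOp_comm {n : ℕ} {p : Fin n → ℂ} (i j : Fin n) :
    (partialOp i * partialOp j : Module.End ℂ (HolGerm p)) = partialOp j * partialOp i := by
  ext1 g
  induction g using HolGerm.ind with
  | h g hg =>
    refine holGerm_eq_iff (hf := analyticAt_pderiv i (analyticAt_pderiv j hg))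
      (hg := analyticAt_pderiv j (analyticAt_pderiv i hg)).2 ?_
    filter_upwards [hg.eventually_analyticAt] with x hx
    have key : ∀ v w : Fin n → ℂ, fderiv ℂ (fun y => fderiv ℂ g y v) x w =
        fderiv ℂ (fderiv ℂ g) x w v := by
      intro v w
      rw [fderiv_clm_apply hx.fderiv.differentiableAt (differentiableAt_const _)]
      simp
    change fderiv ℂ (fun y => fderiv ℂ g y _) x _ = fderiv ℂ (fun y => fderiv ℂ g y _) x _
    rw [key, key]
    exact (hx.contDiffAt.isSymmSndFDerivAt_of_omega).eq _ _

theorem restrGerm_partialOp {n : ℕ} {p : Fin n → ℂ} (i : Fin n) (g : HolGerm (incl p)) :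
    restrGerm p (partialOp i.succ g) = partialOp i (restrGerm p g) := by
  induction g using HolGerm.ind with
  | h g hg =>
    refine holGerm_eq_iff (hf := (analyticAt_pderiv i.succ hg).comp (analyticAt_incl p))
      (hg := analyticAt_pderiv i (hg.comp (analyticAt_incl p))).2 ?_
    filter_upwards [continuous_incl.continuousAt.eventually hg.eventually_analyticAt] with x hx
    have e : (g ∘ incl) = g ∘ inclL n := by
      ext y
      simp [inclL_apply]
    have h1 : fderiv ℂ (g ∘ inclL n) x = (fderiv ℂ g (inclL n x)).comp (inclL n) := by
      have := fderiv_comp x (g := g) (f := inclL n)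
        (by rw [inclL_apply]; exact hx.differentiableAt) (inclL n).differentiableAt
      rwa [(inclL n).fderiv] at this
    have h2 : inclL n (Pi.single i 1) = Pi.single i.succ 1 := by
      rw [inclL_apply]
      ext j
      refine Fin.cases ?_ (fun j => ?_) j
      · simp [incl]
      · simp [incl, Pi.single_apply]
    simp [pderiv, e, h1, h2, inclL_apply]

theorem liftGraph_spec {n : ℕ} {p : Fin n → ℂ} {T : DStalk (incl p) × DStalk p}
    (hT : T ∈ liftGraph p) : ∀ (k : ℕ) (g : HolGerm (incl p)),
      restrGerm p ((partialOp 0 ^ k) (T.1.1 g)) = T.2.1 (restrGerm p ((partialOp 0 ^ k) g)) := by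
  induction hT using Algebra.adjoin_induction with
  | mem T hT =>
    intro k g
    obtain ⟨f, hf, rfl⟩ | ⟨i, rfl⟩ := hT
    · have h1 : Commute (partialOp 0 ^ k) (mulOp (pull f) (analyticAt_pull_incl hf)) :=
        Commute.pow_left (partialOp_mulOp_pull hf) k
      have h2 := LinearMap.congr_fun h1.eq g
      simp only [Module.End.mul_apply] at h2
      change restrGerm p ((partialOp 0 ^ k) (mulOp _ (analyticAt_pull_incl hf) g)) = mulOp f hf _
      rw [h2]
      generalize (partialOp 0 ^ k) g = g'
      induction g' using HolGerm.ind with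
      | h g hg =>
        refine holGerm_eq_iff
          (hf := ((analyticAt_pull_incl hf).mul hg).comp (analyticAt_incl p))
          (hg := hf.mul (hg.comp (analyticAt_incl p))).2 (.of_forall fun x => ?_)
        simp [pull, tail_incl]
    · have h1 : Commute (partialOp 0 ^ k) (partialOp i.succ : Module.End ℂ (HolGerm (incl p))) :=
        Commute.pow_left (partialOp_comm _ _) k
      have h2 := LinearMap.congr_fun h1.eq g
      simp only [Module.End.mul_apply] at h2
      change restrGerm p ((partialOp 0 ^ k) (partialOp _ g)) = partialOp _ _
      rw [h2, restrGerm_partialOp]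
  | algebraMap r =>
    intro k g
    change restrGerm p ((partialOp 0 ^ k) (r • g)) = r • _
    rw [map_smul, map_smul]
    rfl
  | add S T _ _ hS hT =>
    intro k g
    change restrGerm p ((partialOp 0 ^ k) (S.1.1 g + T.1.1 g)) = S.2.1 _ + T.2.1 _
    rw [map_add, map_add, hS, hT]
  | mul S T _ _ hS hT =>
    intro k g
    change restrGerm p ((partialOp 0 ^ k) (S.1.1 (T.1.1 g))) = S.2.1 (T.2.1 _)
    rw [hS, hT]

/-- A holomorphic germ is determined by the restrictions of its derivatives in `x₀`. -/
theorem eq_zero_of_restrGerm {n : ℕ} {p : Fin n → ℂ} (g : HolGerm (incl p))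
    (h : ∀ k : ℕ, restrGerm p ((partialOp 0 ^ k) g) = 0) : g = 0 := by
  induction g using HolGerm.ind with
  | h g hg =>
    obtain ⟨r, hr, hB⟩ := Metric.eventually_nhds_iff_ball.1 hg.eventually_analyticAt
    have hpow : ∀ k, ∀ y ∈ Metric.ball (incl p) r, AnalyticAt ℂ ((pderiv 0)^[k] g) y := by
      intro k
      induction k with
      | zero => exact hB
      | succ k ih =>
        intro y hy
        rw [Function.iterate_succ_apply']
        exact analyticAt_pderiv 0 (ih y hy)
    have hgerm : ∀ k, (partialOp 0 ^ k) (holGerm g hg) =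
        holGerm ((pderiv 0)^[k] g) (hpow k _ (Metric.mem_ball_self hr)) := by
      intro k
      induction k with
      | zero => rfl
      | succ k ih =>
        rw [pow_succ', Module.End.mul_apply, ih, partialOp_holGerm]
        simp only [Function.iterate_succ_apply']
    have hmem : ∀ (c : ℂ) (x : Fin n → ℂ), c ∈ Metric.ball (0 : ℂ) r → x ∈ Metric.ball p r →
        (Fin.cons c x : Fin (n + 1) → ℂ) ∈ Metric.ball (incl p) r := by
      intro c x hc hx
      rw [Metric.mem_ball, dist_pi_lt_iff hr]
      intro j
      refine Fin.cases ?_ (fun j => ?_) j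
      · simpa [incl] using hc
      · simpa [incl] using (dist_pi_lt_iff hr).1 hx j
    have hzero : ∀ k, ∀ x ∈ Metric.ball p r, (pderiv 0)^[k] g (incl x) = 0 := by
      intro k
      have hk := h k
      rw [hgerm, restrGerm_holGerm] at hk
      have hk' := (holGerm_eq_iff (hg := analyticAt_const (v := (0 : ℂ)))).1 hk
      have han : AnalyticOnNhd ℂ (((pderiv 0)^[k] g) ∘ incl) (Metric.ball p r) := fun x hx =>
        AnalyticAt.comp (hpow k _ (hmem 0 x (Metric.mem_ball_self hr) hx)) (analyticAt_incl x)
      exact fun x hx => han.eqOn_zero_of_preconnected_of_eventuallyEq_zero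
        (convex_ball p r).isPreconnected (Metric.mem_ball_self hr) hk' hx
    refine (holGerm_eq_iff (hg := analyticAt_const (v := (0 : ℂ)))).2 ?_
    filter_upwards [Metric.ball_mem_nhds _ hr] with y hy
    have hy' := (dist_pi_lt_iff hr).1 hy
    have hy0 : y 0 ∈ Metric.ball (0 : ℂ) r := by simpa [incl] using hy' 0
    have hyt : Fin.tail y ∈ Metric.ball p r := by
      rw [Metric.mem_ball, dist_pi_lt_iff hr]
      intro j
      simpa [incl, Fin.tail] using hy' j.succ
    set x := Fin.tail y with hx
    have hline : ∀ c : ℂ, HasDerivAt (fun c : ℂ => (Fin.cons c x : Fin (n + 1) → ℂ))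
        (Pi.single 0 1) c := by
      intro c
      rw [hasDerivAt_pi]
      intro j
      refine Fin.cases ?_ (fun j => ?_) j
      · exact hasDerivAt_id c
      · simpa using hasDerivAt_const c (x j)
    have hder : ∀ k, ∀ c ∈ Metric.ball (0 : ℂ) r,
        HasDerivAt (fun c => (pderiv 0)^[k] g (Fin.cons c x))
          ((pderiv 0)^[k + 1] g (Fin.cons c x)) c := by
      intro k c hc
      rw [Function.iterate_succ_apply']
      exact (hpow k _ (hmem c x hc hyt)).differentiableAt.hasFDerivAt.comp_hasDerivAt c (hline c)
    have hiter : ∀ k, ∀ c ∈ Metric.ball (0 : ℂ) r,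
        iteratedDeriv k (fun c => g (Fin.cons c x)) c = (pderiv 0)^[k] g (Fin.cons c x) := by
      intro k
      induction k with
      | zero => intro c _; simp
      | succ k ih =>
        intro c hc
        rw [iteratedDeriv_succ, ← (hder k c hc).deriv]
        refine EventuallyEq.deriv_eq ?_
        filter_upwards [Metric.isOpen_ball.mem_nhds hc] with c' hc' using ih c' hc'
    have hd : DifferentiableOn ℂ (fun c => g (Fin.cons c x)) (Metric.ball (0 : ℂ) r) :=
      fun c hc => (hder 0 c hc).differentiableAt.differentiableWithinAt
    have ht := Complex.taylorSeries_eq_on_ball hd hy0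
    have hcons : (Fin.cons (y 0) x : Fin (n + 1) → ℂ) = y := Fin.cons_self_tail y
    rw [hcons] at ht
    rw [← ht]
    have : ∀ k, iteratedDeriv k (fun c => g (Fin.cons c x)) 0 = 0 := fun k => by
      rw [hiter k 0 (Metric.mem_ball_self hr)]
      exact hzero k x hyt
    simp [this]

theorem liftGraph_snd_bijective {n : ℕ} (p : Fin n → ℂ) :
    Function.Bijective ((AlgHom.snd ℂ (DStalk (incl p)) (DStalk p)).comp (liftGraph p).val) := by
  constructor
  · rintro ⟨⟨T, S⟩, hT⟩ ⟨⟨T', S'⟩, hT'⟩ (h : S = S')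
    subst h
    have : T = T' := by
      refine Subtype.ext (LinearMap.ext fun g => sub_eq_zero.1 ?_)
      refine eq_zero_of_restrGerm _ fun k => ?_
      rw [map_sub, map_sub, liftGraph_spec hT, liftGraph_spec hT', sub_self]
    subst this
    rfl
  · rintro ⟨S, hS⟩
    suffices h : ∃ T, (T, (⟨S, hS⟩ : DStalk p)) ∈ liftGraph p by
      obtain ⟨T, hT⟩ := h
      exact ⟨⟨_, hT⟩, rfl⟩
    induction hS using Algebra.adjoin_induction with
    | mem S hS =>
      obtain ⟨f, hf, rfl⟩ | ⟨i, rfl⟩ := hS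
      · exact ⟨_, Algebra.subset_adjoin (Or.inl ⟨f, hf, rfl⟩)⟩
      · exact ⟨_, Algebra.subset_adjoin (Or.inr ⟨i, rfl⟩)⟩
    | algebraMap r => exact ⟨_, (liftGraph p).algebraMap_mem r⟩
    | add x y _ _ hx hy =>
      obtain ⟨T, hT⟩ := hx
      obtain ⟨S, hS⟩ := hy
      exact ⟨_, (liftGraph p).add_mem hT hS⟩
    | mul x y _ _ hx hy =>
      obtain ⟨T, hT⟩ := hx
      obtain ⟨S, hS⟩ := hy
      exact ⟨_, (liftGraph p).mul_mem hT hS⟩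

/-- The ring homomorphism `𝒟_{ℂⁿ,p} → 𝒟_{ℂⁿ⁺¹,(0,p)}` with `f(x) ↦ f(x)` and `∂ᵢ ↦ ∂ᵢ`; the
coordinate `xᵢ` of `ℂⁿ` is the coordinate with index `i.succ` of `ℂⁿ⁺¹`. -/
def liftD {n : ℕ} (p : Fin n → ℂ) : DStalk p →ₐ[ℂ] DStalk (incl p) :=
  ((AlgHom.fst ℂ (DStalk (incl p)) (DStalk p)).comp (liftGraph p).val).comp
    (AlgEquiv.ofBijective _ (liftGraph_snd_bijective p)).symm.toAlgHom

theorem liftD_eq {n : ℕ} {p : Fin n → ℂ} {T : DStalk (incl p)} {S : DStalk p}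
    (h : (T, S) ∈ liftGraph p) : liftD p S = T := by
  have : (AlgEquiv.ofBijective _ (liftGraph_snd_bijective p)).symm S = ⟨(T, S), h⟩ := by
    rw [AlgEquiv.symm_apply_eq]
    rfl
  change ((AlgEquiv.ofBijective _ (liftGraph_snd_bijective p)).symm S).1.1 = T
  rw [this]

theorem liftD_mulD {n : ℕ} {p : Fin n → ℂ} {f : (Fin n → ℂ) → ℂ} (hf : AnalyticAt ℂ f p) :
    liftD p (mulD f hf) = mulD (pull f) (analyticAt_pull_incl hf) :=
  liftD_eq (Algebra.subset_adjoin (Or.inl ⟨f, hf, rfl⟩))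

theorem liftD_partialD {n : ℕ} {p : Fin n → ℂ} (i : Fin n) :
    liftD p (partialD i) = partialD i.succ :=
  liftD_eq (Algebra.subset_adjoin (Or.inr ⟨i, rfl⟩))

/-! ### The sheaf of differential operators -/

/-- The complex manifold `ℂⁿ` as a topological space. -/
abbrev X (n : ℕ) : TopCat := TopCat.of (Fin n → ℂ)

/-- The operator `f` over an open set on which `f` is holomorphic. -/
def mulSec {n : ℕ} (U : Opens (X n)) (f : (Fin n → ℂ) → ℂ) (hf : ∀ x ∈ U, AnalyticAt ℂ f x) :
    ∀ x : U, DStalk (x.1 : Fin n → ℂ) :=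
  fun x => mulD f (hf x.1 x.2)

/-- The operators over `U` that are noncommutative polynomials in holomorphic functions on `U` and
in `∂₁, …, ∂ₙ`, each regarded as the family of its germs. -/
def basicSections {n : ℕ} (U : Opens (X n)) :
    Subalgebra ℂ (∀ x : U, DStalk (x.1 : Fin n → ℂ)) :=
  Algebra.adjoin ℂ ({P | ∃ f, ∃ hf : ∀ x ∈ U, AnalyticAt ℂ f x, P = mulSec U f hf} ∪
    Set.range fun i _ => partialD i)

theorem basicSections_res {n : ℕ} {U V : Opens (X n)} (i : U ⟶ V)
    {P : ∀ x : V, DStalk (x.1 : Fin n → ℂ)} (hP : P ∈ basicSections V) :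
    (fun x : U => P ⟨x.1, i.le x.2⟩) ∈ basicSections U := by
  induction hP using Algebra.adjoin_induction with
  | mem P hP =>
    obtain ⟨f, hf, rfl⟩ | ⟨j, rfl⟩ := hP
    · exact Algebra.subset_adjoin (Or.inl ⟨f, fun x hx => hf x (i.le hx), rfl⟩)
    · exact Algebra.subset_adjoin (Or.inr ⟨j, rfl⟩)
  | algebraMap r => exact (basicSections U).algebraMap_mem r
  | add P Q _ _ hP hQ => exact (basicSections U).add_mem hP hQ
  | mul P Q _ _ hP hQ => exact (basicSections U).mul_mem hP hQ

def basicPrelocal (n : ℕ) : TopCat.PrelocalPredicate fun x : X n => DStalk (x : Fin n → ℂ) where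
  pred {U} P := P ∈ basicSections U
  res i _ hP := basicSections_res i hP

/-- The sections over `U` of the sheaf `𝒟` of linear differential operators with holomorphic
coefficients, each given by the family of its germs. -/
def DSections {n : ℕ} (U : Opens (X n)) : Subalgebra ℂ (∀ x : U, DStalk (x.1 : Fin n → ℂ)) where
  carrier := {P | (basicPrelocal n).sheafify.pred P}
  mul_mem' hP hQ := TopCat.PrelocalPredicate.sheafify_inductionOn₂' _ _ _ (fun a b => a * b)
    (fun ha hb => (basicSections _).mul_mem (basicSections_res (Opens.infLELeft _ _) ha)
      (basicSections_res (Opens.infLERight _ _) hb)) hP hQ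
  add_mem' hP hQ := TopCat.PrelocalPredicate.sheafify_inductionOn₂' _ _ _ (fun a b => a + b)
    (fun ha hb => (basicSections _).add_mem (basicSections_res (Opens.infLELeft _ _) ha)
      (basicSections_res (Opens.infLERight _ _) hb)) hP hQ
  algebraMap_mem' r := TopCat.PrelocalPredicate.sheafifyOf ((basicSections U).algebraMap_mem r)

theorem basicSections_le {n : ℕ} (U : Opens (X n)) : basicSections U ≤ DSections U :=
  fun _ hP => TopCat.PrelocalPredicate.sheafifyOf hP

theorem DSections_res {n : ℕ} {U V : Opens (X n)} (h : U ≤ V)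
    {P : ∀ x : V, DStalk (x.1 : Fin n → ℂ)} (hP : P ∈ DSections V) :
    (fun x : U => P ⟨x.1, h x.2⟩) ∈ DSections U :=
  (basicPrelocal n).sheafify.res (homOfLE h) P hP

/-- The presheaf of rings underlying `𝒟`. -/
def DPresheaf (n : ℕ) : TopCat.Presheaf RingCat (X n) where
  obj U := RingCat.of (DSections U.unop)
  map i := RingCat.ofHom
    { toFun P := ⟨fun x => P.1 ⟨x.1, i.unop.le x.2⟩, DSections_res i.unop.le P.2⟩
      map_one' := rfl
      map_mul' _ _ := rfl
      map_zero' := rfl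
      map_add' _ _ := rfl }
  map_id _ := rfl
  map_comp _ _ := rfl

def DPresheafForgetIso (n : ℕ) : (TopCat.subsheafToTypes (basicPrelocal n).sheafify).obj ≅
    DPresheaf n ⋙ forget RingCat :=
  NatIso.ofComponents (fun _ => Iso.refl _) fun _ => rfl

/-- The sheaf of rings `𝒟` on `ℂⁿ` of linear differential operators with holomorphic
coefficients. -/
def DSheaf (n : ℕ) : TopCat.Sheaf RingCat (X n) :=
  ⟨DPresheaf n, (TopCat.Presheaf.isSheaf_iff_isSheaf_comp (forget RingCat) _).2
    (TopCat.Presheaf.isSheaf_of_iso (DPresheafForgetIso n)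
      (TopCat.subsheafToTypes (basicPrelocal n).sheafify).property)⟩

/-! ### Sheaves of modules with prescribed stalks -/

/-- Mathlib's category of sheaves of left `𝒟`-modules, with the universe levels made explicit. -/
instance instCategoryDMod (n : ℕ) : Category.{0, 1} (SheafOfModules.{0} (DSheaf n)) :=
  SheafOfModules.instCategory.{0, 0, 0, 0}

section

variable {n : ℕ} (N : X n → Type) [∀ x, AddCommGroup (N x)]
  [∀ x, Module (DStalk (x : Fin n → ℂ)) (N x)] (B : TopCat.PrelocalPredicate N)
  (h0 : ∀ U : Opens (X n), B.pred (0 : ∀ x : U, N x))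
  (hadd : ∀ {U : Opens (X n)} {s t : ∀ x : U, N x}, B.pred s → B.pred t → B.pred (s + t))
  (hsmul : ∀ {U : Opens (X n)} {P : ∀ x : U, DStalk (x.1 : Fin n → ℂ)} {s : ∀ x : U, N x},
    P ∈ basicSections U → B.pred s → B.pred fun x => P x • s x)

/-- The families of germs over `U` that locally belong to `B`. -/
def modSections (U : Opens (X n)) : Submodule (DSections U) (∀ x : U, N x) where
  carrier := {s | B.sheafify.pred s}
  zero_mem' := TopCat.PrelocalPredicate.sheafifyOf (h0 U)
  add_mem' hs ht := TopCat.PrelocalPredicate.sheafify_inductionOn₂' _ _ _ (fun a b => a + b)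
    (fun ha hb => hadd (B.res (Opens.infLELeft _ _) _ ha) (B.res (Opens.infLERight _ _) _ hb)) hs ht
  smul_mem' P _ hs := TopCat.PrelocalPredicate.sheafify_inductionOn₂' (basicPrelocal n) _ _
    (fun a b => a • b) (fun ha hb => hsmul (basicSections_res (Opens.infLELeft _ _) ha)
      (B.res (Opens.infLERight _ _) _ hb)) P.2 hs

instance modSectionsModule (U : (Opens (X n))ᵒᵖ) :
    Module ((DSheaf n).obj.obj U) (modSections N B h0 hadd hsmul U.unop) :=
  inferInstanceAs (Module (DSections U.unop) (modSections N B h0 hadd hsmul U.unop))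

/-- The presheaf of `𝒟`-modules underlying `modSheaf`. -/
def modPresheaf : PresheafOfModules (DSheaf n).obj where
  obj U := ModuleCat.of ((DSheaf n).obj.obj U) (modSections N B h0 hadd hsmul U.unop)
  map {U V} i := ModuleCat.semilinearMapAddEquiv ((DSheaf n).obj.map i).hom
    (ModuleCat.of ((DSheaf n).obj.obj U) (modSections N B h0 hadd hsmul U.unop))
    (ModuleCat.of ((DSheaf n).obj.obj V) (modSections N B h0 hadd hsmul V.unop))
    { toFun s := ⟨fun x => s.1 ⟨x.1, i.unop.le x.2⟩, B.sheafify.res i.unop s.1 s.2⟩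
      map_add' _ _ := rfl
      map_smul' _ _ := rfl }
  map_id _ := rfl
  map_comp _ _ := rfl

def modPresheafForgetIso : (TopCat.subsheafToTypes B.sheafify).obj ≅
    (modPresheaf N B h0 hadd hsmul).presheaf ⋙ forget Ab :=
  NatIso.ofComponents (fun _ => Iso.refl _) fun _ => rfl

/-- The sheaf of left `𝒟`-modules whose sections over `U` are the families `(sₓ)`, `sₓ ∈ N x`,
that locally belong to `B`. -/
def modSheaf : SheafOfModules (DSheaf n) where
  val := modPresheaf N B h0 hadd hsmul
  isSheaf := (TopCat.Presheaf.isSheaf_iff_isSheaf_comp (forget Ab) _).2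
    (TopCat.Presheaf.isSheaf_of_iso (modPresheafForgetIso N B h0 hadd hsmul)
      (TopCat.subsheafToTypes B.sheafify).property)

end

/-! ### Hypergeometric systems -/

/-- The Weyl algebra `Aₙ`: the differential operators on `ℂⁿ` with polynomial coefficients. -/
def Weyl (n : ℕ) : Subalgebra ℂ (∀ p : Fin n → ℂ, DStalk p) :=
  Algebra.adjoin ℂ ((Set.range fun i _ => coordD i) ∪ Set.range fun i _ => partialD i)

/-- `xᵢ` in the Weyl algebra. -/
def wx {n : ℕ} (i : Fin n) : Weyl n :=
  ⟨fun _ => coordD i, Algebra.subset_adjoin (Or.inl ⟨i, rfl⟩)⟩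

/-- `∂ᵢ` in the Weyl algebra. -/
def wd {n : ℕ} (i : Fin n) : Weyl n :=
  ⟨fun _ => partialD i, Algebra.subset_adjoin (Or.inr ⟨i, rfl⟩)⟩

/-- The monomial `∂₁^{k₁} ⋯ ∂ₙ^{kₙ}`. -/
def wdPow {n : ℕ} (k : Fin n → ℕ) : Weyl n := (List.ofFn fun i => wd i ^ k i).prod

/-- The binomial `∂^{u₊} - ∂^{u₋}`. -/
def toricOp {n : ℕ} (u : Fin n → ℤ) : Weyl n :=
  wdPow (fun i => (u i).toNat) - wdPow (fun i => (-u i).toNat)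

/-- The Euler operator `∑ aᵢ xᵢ ∂ᵢ - β` of the row matrix `a = (a₁ … aₙ)`. -/
def eulerOp {n : ℕ} (a : Fin n → ℤ) (β : ℂ) : Weyl n :=
  (∑ i, (a i : ℂ) • (wx i * wd i)) - algebraMap ℂ (Weyl n) β

/-- The hypergeometric ideal `H_a(β)`, a left ideal of the Weyl algebra. -/
def hypIdeal {n : ℕ} (a : Fin n → ℤ) (β : ℂ) : Submodule (Weyl n) (Weyl n) :=
  Submodule.span (Weyl n) ({P | ∃ u : Fin n → ℤ, ∑ i, a i * u i = 0 ∧ P = toricOp u} ∪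
    {eulerOp a β})

/-- The stalk at `p` of the sheaf of left ideals `𝒟 H_a(β)`. -/
def hypStalk {n : ℕ} (a : Fin n → ℤ) (β : ℂ) (p : Fin n → ℂ) : Submodule (DStalk p) (DStalk p) :=
  Submodule.span (DStalk p) ((fun P : Weyl n => P.1 p) '' (hypIdeal a β))

/-- The stalk at `p` of `𝒟 / 𝒟 H_a(β)`. -/
abbrev HypMod {n : ℕ} (a : Fin n → ℤ) (β : ℂ) (p : Fin n → ℂ) : Type :=
  DStalk p ⧸ hypStalk a β p

/-- The families of germs that are classes of a section of `𝒟`. -/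
def hypPrelocal {n : ℕ} (a : Fin n → ℤ) (β : ℂ) :
    TopCat.PrelocalPredicate fun x : X n => HypMod a β x where
  pred {U} s := ∃ P ∈ DSections U, ∀ x : U, s x = Submodule.Quotient.mk (P x)
  res := by
    rintro U V i s ⟨P, hP, hs⟩
    exact ⟨_, DSections_res i.le hP, fun x => hs _⟩

/-- The analytic hypergeometric `𝒟`-module `ℳ_a(β) = 𝒟 / 𝒟 H_a(β)` on `ℂⁿ`. -/
def hypSheaf {n : ℕ} (a : Fin n → ℤ) (β : ℂ) : SheafOfModules (DSheaf n) :=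
  modSheaf (fun x : X n => HypMod a β x) (hypPrelocal a β)
    (fun U => ⟨0, (DSections U).zero_mem, fun _ => rfl⟩)
    (by
      rintro U s t ⟨P, hP, hs⟩ ⟨Q, hQ, ht⟩
      exact ⟨P + Q, (DSections U).add_mem hP hQ, fun x => by
        rw [Pi.add_apply, hs, ht]
        rfl⟩)
    (by
      rintro U P s hP ⟨Q, hQ, hs⟩
      exact ⟨P * Q, (DSections U).mul_mem (basicSections_le U hP) hQ, fun x => by
        change P x • s x = _
        rw [hs]
        rfl⟩)

/-! ### Restriction to the hyperplane `x₀ = 0` -/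

/-- The action of `𝒟_{ℂⁿ,p}` on `𝒟_{ℂⁿ⁺¹,(0,p)}` by left multiplication with operators not
involving `x₀` and `∂₀`. -/
instance liftModule {n : ℕ} (p : Fin n → ℂ) : Module (DStalk p) (DStalk (incl p)) :=
  Module.compHom _ (liftD p).toRingHom

theorem lift_smul_def {n : ℕ} {p : Fin n → ℂ} (P : DStalk p) (Q : DStalk (incl p)) :
    P • Q = liftD p P * Q := rfl

/-- Operators not involving `x₀` and `∂₀` commute with `x₀`. -/
theorem liftD_coordD {n : ℕ} {p : Fin n → ℂ} (P : DStalk p) :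
    liftD p P * coordD 0 = coordD 0 * liftD p P := by
  obtain ⟨S, hS⟩ := P
  induction hS using Algebra.adjoin_induction with
  | mem S hS =>
    obtain ⟨f, hf, rfl⟩ | ⟨i, rfl⟩ := hS
    · refine (congrArg (· * coordD 0) (liftD_mulD hf)).trans
        (Eq.trans ?_ (congrArg (coordD 0 * ·) (liftD_mulD hf)).symm)
      exact Subtype.ext (LinearMap.ext fun g => Subtype.ext (mul_left_comm _ _ _))
    · refine (congrArg (· * coordD 0) (liftD_partialD i)).trans
        (Eq.trans ?_ (congrArg (coordD 0 * ·) (liftD_partialD i)).symm)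
      refine Subtype.ext (LinearMap.ext fun g => ?_)
      induction g using HolGerm.ind with
      | h g hg =>
        refine holGerm_eq_iff
          (hf := analyticAt_pderiv i.succ ((analyticAt_coord 0 (incl p)).mul hg))
          (hg := (analyticAt_coord 0 (incl p)).mul (analyticAt_pderiv i.succ hg)).2 ?_
        filter_upwards [hg.eventually_analyticAt] with x hx
        have h1 : fderiv ℂ (fun x : Fin (n + 1) → ℂ => x 0) x =
            ContinuousLinearMap.proj (R := ℂ) (φ := fun _ : Fin (n + 1) => ℂ) 0 :=
          (ContinuousLinearMap.proj (R := ℂ) (φ := fun _ : Fin (n + 1) => ℂ) 0).fderiv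
        simp [pderiv, fderiv_mul (analyticAt_coord 0 x).differentiableAt hx.differentiableAt, h1]
  | algebraMap r =>
    refine (congrArg (· * coordD 0) ((liftD p).commutes r)).trans
      (Eq.trans ?_ (congrArg (coordD 0 * ·) ((liftD p).commutes r)).symm)
    exact Algebra.commutes _ _
  | add S T hS hT h1 h2 =>
    have e := map_add (liftD p) ⟨S, hS⟩ ⟨T, hT⟩
    refine (congrArg (· * coordD 0) e).trans (Eq.trans ?_ (congrArg (coordD 0 * ·) e).symm)
    simp only [add_mul, mul_add, h1, h2]
  | mul S T hS hT h1 h2 =>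
    have e := map_mul (liftD p) ⟨S, hS⟩ ⟨T, hT⟩
    refine (congrArg (· * coordD 0) e).trans (Eq.trans ?_ (congrArg (coordD 0 * ·) e).symm)
    simp only [mul_assoc, h2]
    simp only [← mul_assoc, h1]

/-- The stalk at `(0, p)` of `𝒟 H_{a'}(β) + x₀ 𝒟`, for `𝒟` the sheaf of differential operators on
`ℂⁿ⁺¹`; it is stable under `𝒟_{ℂⁿ,p}`. -/
def restrStalk {n : ℕ} (a' : Fin (n + 1) → ℤ) (β : ℂ) (p : Fin n → ℂ) :
    Submodule (DStalk p) (DStalk (incl p)) where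
  carrier := {P | ∃ Q ∈ hypStalk a' β (incl p), ∃ R : DStalk (incl p), P = Q + coordD 0 * R}
  zero_mem' := ⟨0, Submodule.zero_mem _, 0, by simp⟩
  add_mem' := by
    rintro _ _ ⟨Q, hQ, R, rfl⟩ ⟨Q', hQ', R', rfl⟩
    exact ⟨Q + Q', Submodule.add_mem _ hQ hQ', R + R', by rw [mul_add]; abel⟩
  smul_mem' := by
    rintro P _ ⟨Q, hQ, R, rfl⟩
    refine ⟨liftD p P * Q, Submodule.smul_mem _ (liftD p P) hQ, liftD p P * R, ?_⟩
    rw [lift_smul_def, mul_add, ← mul_assoc, liftD_coordD, mul_assoc]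

/-- The stalk at `(0, p)` of `𝒟 / (𝒟 H_{a'}(β) + x₀ 𝒟)`, as a module over `𝒟_{ℂⁿ,p}`. -/
abbrev RestrMod {n : ℕ} (a' : Fin (n + 1) → ℤ) (β : ℂ) (p : Fin n → ℂ) : Type :=
  DStalk (incl p) ⧸ restrStalk a' β p

/-- The families of germs along the hyperplane that are classes of a section of the sheaf `𝒟` of
`ℂⁿ⁺¹` over a neighbourhood of the given part of the hyperplane. -/
def restrPrelocal {n : ℕ} (a' : Fin (n + 1) → ℤ) (β : ℂ) :
    TopCat.PrelocalPredicate fun x : X n => RestrMod a' β x where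
  pred {U} s := ∃ W : Opens (X (n + 1)), ∃ P ∈ DSections W, ∃ hW : ∀ x ∈ U, incl x ∈ W,
    ∀ x : U, s x = Submodule.Quotient.mk (P ⟨incl x.1, hW x.1 x.2⟩)
  res := by
    rintro U V i s ⟨W, P, hP, hW, hs⟩
    exact ⟨W, P, hP, fun x hx => hW x (i.le hx), fun x => hs _⟩

/-- A section of `𝒟` on `ℂⁿ` extends to one on `ℂⁿ⁺¹` not involving `x₀` and `∂₀`. -/
theorem exists_lift_section {n : ℕ} {U : Opens (X n)} {P : ∀ x : U, DStalk (x.1 : Fin n → ℂ)}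
    (hP : P ∈ basicSections U) (W : Opens (X (n + 1))) (hW : ∀ y ∈ W, Fin.tail y ∈ U) :
    ∃ P' ∈ DSections W, ∀ (x : U) (hx : incl x.1 ∈ W), P' ⟨incl x.1, hx⟩ = liftD x.1 (P x) := by
  suffices h : ∃ P' ∈ basicSections W, ∀ (x : U) (hx : incl x.1 ∈ W),
      P' ⟨incl x.1, hx⟩ = liftD x.1 (P x) by
    obtain ⟨P', hP', h⟩ := h
    exact ⟨P', basicSections_le W hP', h⟩
  induction hP using Algebra.adjoin_induction with
  | mem P hP =>
    obtain ⟨f, hf, rfl⟩ | ⟨i, rfl⟩ := hP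
    · exact ⟨mulSec W (pull f) fun y hy => analyticAt_pull (hf _ (hW y hy)),
        Algebra.subset_adjoin (Or.inl ⟨_, _, rfl⟩), fun x _ => (liftD_mulD (hf x.1 x.2)).symm⟩
    · exact ⟨fun _ => partialD i.succ, Algebra.subset_adjoin (Or.inr ⟨_, rfl⟩),
        fun x _ => (liftD_partialD i).symm⟩
  | algebraMap r =>
    exact ⟨_, (basicSections W).algebraMap_mem r, fun x _ => ((liftD x.1).commutes r).symm⟩
  | add P Q _ _ hP hQ =>
    obtain ⟨P', hP', h1⟩ := hP
    obtain ⟨Q', hQ', h2⟩ := hQ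
    refine ⟨_, (basicSections W).add_mem hP' hQ', fun x hx => ?_⟩
    rw [Pi.add_apply, Pi.add_apply, h1, h2, map_add]
  | mul P Q _ _ hP hQ =>
    obtain ⟨P', hP', h1⟩ := hP
    obtain ⟨Q', hQ', h2⟩ := hQ
    refine ⟨_, (basicSections W).mul_mem hP' hQ', fun x hx => ?_⟩
    rw [Pi.mul_apply, Pi.mul_apply, h1, h2, map_mul]

/-- The restriction `𝒟 / (𝒟 H_{a'}(β) + x₀ 𝒟)` of `ℳ_{a'}(β)` to the hyperplane `x₀ = 0` of `ℂⁿ⁺¹`,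
as a sheaf of left `𝒟`-modules on `ℂⁿ`. -/
def restrSheaf {n : ℕ} (a' : Fin (n + 1) → ℤ) (β : ℂ) : SheafOfModules (DSheaf n) :=
  modSheaf (fun x : X n => RestrMod a' β x) (restrPrelocal a' β)
    (fun U => ⟨⊤, 0, (DSections ⊤).zero_mem, fun _ _ => trivial, fun _ => rfl⟩)
    (by
      rintro U s t ⟨V, P, hP, hV, hs⟩ ⟨W, Q, hQ, hW, ht⟩
      exact ⟨V ⊓ W, _, (DSections (V ⊓ W)).add_mem
        (DSections_res inf_le_left hP) (DSections_res inf_le_right hQ),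
        fun x hx => ⟨hV x hx, hW x hx⟩, fun x => by
          rw [Pi.add_apply, hs, ht]
          rfl⟩)
    (by
      rintro U P s hP ⟨W, Q, hQ, hW, hs⟩
      let W' : Opens (X (n + 1)) := W ⊓ ⟨{y | Fin.tail y ∈ U},
        U.2.preimage (tailL n).continuous⟩
      obtain ⟨P', hP', h⟩ := exists_lift_section hP W' fun y hy => hy.2
      refine ⟨W', _, (DSections W').mul_mem hP'
        (DSections_res inf_le_left hQ),
        fun x hx => ⟨hW x hx, ?_⟩, fun x => ?_⟩
      · change Fin.tail (incl x) ∈ U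
        rwa [tail_incl]
      · change P x • s x = _
        rw [hs, Pi.mul_apply, h]
        rfl)
end HolD

end

/-! Both modules represent the same kind of data. For a left `𝒟`-module `M` on `ℂⁿ`, call `(ψⱼ)` a
family with parameter `β` (`IsFamily`) if `∂ᵢ ψⱼ = ψ_{j+aᵢ}` and `∑ aᵢ xᵢ ψ_{j+aᵢ} = (β - j) ψⱼ`.

Restriction side. Modulo `x₀ 𝒟` every operator on `ℂⁿ⁺¹` is uniquely `∑ Pₖ ∂₀ᵏ` with `Pₖ` not
involving `x₀, ∂₀` (`partialCombEquiv`). Existence rests on dividing holomorphic functions by `x₀`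
(`exists_eq_pull_add_coord_mul`), uniqueness on applying the operator to `f x₀ʲ`. In the quotient
the toric binomials become `∂ᵢ ∂₀ᵏ = ∂₀^{k+aᵢ}`, and `∂₀ᵏ` times the Euler operator becomes the
Euler relation for `∂₀ᵏ` with constant `β - k`. Hence maps out of the restriction are exactly the
families over `ℕ` with parameter `β` (`restrLift`, `restrMod_hom_ext`).

Hypergeometric side. In `ℳ_a(β')` the class of `∂ᵘ` depends only on the degree `∑ aᵢ uᵢ`, so these
classes form a family indexed by the semigroup `S` generated by the `aᵢ`. A family over all of `ℕ`
defines a map out of `ℳ_a(β')` (`hypLift`).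

Filling gaps. If `c` is missing and `β' ≠ c`, the Euler relation at `c` can be solved for `ψ_c`, and
the result is again a family. Since `S` is cofinite, a family over `S` extends to `ℕ`, uniquely, as
long as `β'` is not a gap (`IsFamily.exists_extend`, `IsFamily.ext`). In the same way a family over
`ℕ` with parameter `β`, shifted to the indices `≥ m` with parameter `β + m`, extends down to `0`
unless `β + m` is one of `0, …, m - 1`. If both conditions hold, the two universal families give
inverse maps (`nonempty_restrSheaf_iso`). For `β` not a gap take `m = 0`; for one of the finitely
many gaps take `m` beyond the last gap.

To get sheaves rather than stalks, the extensions are made with global sections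
(`IsModSheaf.exists_extend_sections`), and the stalk maps are checked to preserve sections in both
directions (`IsModSheaf.nonempty_iso`). -/

noncomputable section

namespace HolD

/-! ### Ordered monomials and Euler families -/

section Family

variable {R M : Type*} [Ring R] [AddCommGroup M] [Module R M] {n : ℕ}

/-- The ordered monomial `d₁^{k₁} ⋯ dₙ^{kₙ}`. -/
def ordPow {S : Type*} [Monoid S] {n : ℕ} (d : Fin n → S) (k : Fin n → ℕ) : S :=
  (List.ofFn fun i => d i ^ k i).prod

theorem ordPow_zero {S : Type*} [Monoid S] (d : Fin 0 → S) (k : Fin 0 → ℕ) : ordPow d k = 1 := by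
  simp [ordPow]

theorem ordPow_succ {S : Type*} [Monoid S] (d : Fin (n + 1) → S) (k : Fin (n + 1) → ℕ) :
    ordPow d k = d 0 ^ k 0 * ordPow (fun i => d i.succ) (fun i => k i.succ) := by
  simp [ordPow, List.ofFn_succ]

theorem map_ordPow {S S' F : Type*} [Monoid S] [Monoid S'] [FunLike F S S']
    [MonoidHomClass F S S'] (φ : F) (d : Fin n → S) (k : Fin n → ℕ) :
    φ (ordPow d k) = ordPow (fun i => φ (d i)) k := by
  induction n with
  | zero => simp [ordPow_zero]
  | succ n ih => rw [ordPow_succ, ordPow_succ, map_mul, map_pow, ih]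

theorem commute_ordPow {S : Type*} [Monoid S] {d : Fin n → S} {r : S} (h : ∀ i, Commute r (d i))
    (k : Fin n → ℕ) : Commute r (ordPow d k) := by
  induction n with
  | zero => rw [ordPow_zero]; exact Commute.one_right r
  | succ n ih =>
    rw [ordPow_succ]
    exact ((h 0).pow_right _).mul_right (ih (fun i => h i.succ) _)

theorem ordPow_add {S : Type*} [Monoid S] {d : Fin n → S} (h : ∀ i j, Commute (d i) (d j))
    (k l : Fin n → ℕ) : ordPow d (k + l) = ordPow d k * ordPow d l := by
  induction n with
  | zero => simp [ordPow_zero]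
  | succ n ih =>
    have hc : Commute (d 0 ^ l 0) (ordPow (fun i => d i.succ) (fun i => k i.succ)) :=
      (commute_ordPow (fun i => h 0 i.succ) _).pow_left _
    have e : (fun i : Fin n => (k + l) i.succ) = (fun i => k i.succ) + fun i => l i.succ := rfl
    rw [ordPow_succ, ordPow_succ d k, ordPow_succ d l, e, ih (fun i j => h i.succ j.succ),
      Pi.add_apply, pow_add, mul_assoc, mul_assoc, ← mul_assoc (d 0 ^ l 0), hc.eq]
    simp only [mul_assoc]

theorem ordPow_single {S : Type*} [Monoid S] (d : Fin n → S) (i : Fin n) (k : ℕ) :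
    ordPow d (Pi.single i k) = d i ^ k := by
  have h0 : ∀ (m : ℕ) (d : Fin m → S), ordPow d (fun _ => 0) = 1 := by
    intro m d
    simp [ordPow]
  induction n with
  | zero => exact i.elim0
  | succ n ih =>
    rw [ordPow_succ]
    refine Fin.cases ?_ (fun j => ?_) i
    · simp [h0]
    · have : (fun i : Fin n => (Pi.single j.succ k : Fin (n + 1) → ℕ) i.succ) = Pi.single j k := by
        ext i
        simp [Pi.single_apply]
      rw [this, ih]
      simp

/-- The commutation relations between coordinates and partial derivatives. -/
structure WeylRel (x d : Fin n → R) : Prop where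
  comm : ∀ i j, Commute (d i) (d j)
  leibniz : ∀ i j, d i * x j = x j * d i + if i = j then 1 else 0

variable {x d : Fin n → R} {a : Fin n → ℕ} {ψ : ℕ → M}

theorem ordPow_smul_of_shift (h : ∀ j i, d i • ψ j = ψ (j + a i)) (u : Fin n → ℕ) (j : ℕ) :
    ordPow d u • ψ j = ψ (j + ∑ i, u i * a i) := by
  induction n with
  | zero => simp [ordPow_zero]
  | succ n ih =>
    have hp : ∀ k j, d 0 ^ k • ψ j = ψ (j + k * a 0) := by
      intro k
      induction k with
      | zero => simp
      | succ k ihk =>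
        intro j
        rw [pow_succ, mul_smul, h, ihk]
        congr 1
        ring
    rw [ordPow_succ, mul_smul, ih (d := fun i => d i.succ) (a := fun i => a i.succ)
      (fun j i => h j i.succ), hp, Fin.sum_univ_succ]
    congr 1
    ring

/-- The Euler operator without its constant term. -/
def eulerSum (x d : Fin n → R) (a : Fin n → ℕ) : R := ∑ i, a i • (x i * d i)

/-- The Euler operator is a grading operator: `∂ᵢ` commutes with every `xₖ ∂ₖ` except for `k = i`,
where the Leibniz rule contributes one extra `∂ᵢ` with weight `aᵢ`. -/
theorem WeylRel.mul_eulerSum (hR : WeylRel x d) (i : Fin n) :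
    d i * eulerSum x d a = (eulerSum x d a + (a i : R)) * d i := by
  have e : ∀ k, d i * (a k • (x k * d k)) =
      a k • (x k * d k) * d i + if i = k then (a k : R) * d k else 0 := by
    intro k
    rw [mul_smul_comm, ← mul_assoc, hR.leibniz, add_mul, mul_assoc, (hR.comm i k).eq, smul_add,
      ← mul_assoc, smul_mul_assoc]
    split_ifs <;> simp
  rw [eulerSum, Finset.mul_sum, Finset.sum_congr rfl fun k _ => e k, Finset.sum_add_distrib,
    ← Finset.sum_mul, Finset.sum_ite_eq, add_mul]
  simp

theorem pow_mul_of_shift {E r : R} {c : ℕ} (h : r * E = (E + (c : R)) * r) (k : ℕ) :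
    r ^ k * E = (E + ((k * c : ℕ) : R)) * r ^ k := by
  induction k with
  | zero => simp
  | succ k ih =>
    rw [pow_succ, mul_assoc, h, ← mul_assoc, mul_add, ih, ← Nat.cast_commute, ← add_mul,
      mul_assoc]
    congr 1
    push_cast
    rw [add_mul, one_mul, add_assoc]

theorem ordPow_mul_of_shift {E : R} (h : ∀ i, d i * E = (E + (a i : R)) * d i) (u : Fin n → ℕ) :
    ordPow d u * E = (E + ((∑ i, u i * a i : ℕ) : R)) * ordPow d u := by
  induction n with
  | zero => simp [ordPow_zero]
  | succ n ih =>
    rw [ordPow_succ, mul_assoc, ih (d := fun i => d i.succ) (a := fun i => a i.succ)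
      (fun i => h i.succ), ← mul_assoc, mul_add, pow_mul_of_shift (h 0), ← Nat.cast_commute,
      ← add_mul, Fin.sum_univ_succ, mul_assoc]
    congr 1
    push_cast
    rw [add_assoc]

/-! ### Families satisfying the Euler relation: extension, uniqueness, shifts -/

variable [Algebra ℂ R] {β : ℂ} {T : Set ℕ}

/-- A family `(ψⱼ)` that behaves for `j ∈ T` like `ψⱼ = ∂ᵘ ψ₀`, `∑ aᵢ uᵢ = j`, for a vector `ψ₀`
killed by the Euler operator `∑ aᵢ xᵢ ∂ᵢ - β`. -/
structure IsFamily (x d : Fin n → R) (a : Fin n → ℕ) (β : ℂ) (T : Set ℕ) (ψ : ℕ → M) : Prop where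
  partial_smul : ∀ j ∈ T, ∀ i, d i • ψ j = ψ (j + a i)
  euler : ∀ j ∈ T, ∑ i, a i • x i • ψ (j + a i) = algebraMap ℂ R (β - j) • ψ j

/-- The Euler relation at `c` forces the new value, since `β - c` is invertible. Applying `∂ᵢ` to
it, the Leibniz term gives `aᵢ ψ_{c+aᵢ}` and the rest is the Euler relation at `c + aᵢ` with
constant `β - c - aᵢ`; together they give `(β - c) ψ_{c+aᵢ}`, as needed. -/
theorem IsFamily.extend_insert (hR : WeylRel x d) (h : IsFamily x d a β T ψ)
    {c : ℕ} (hc : c ∉ T) (ha : ∀ i, 0 < a i) (hT : ∀ i, c + a i ∈ T)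
    (hT' : ∀ j ∈ T, ∀ i, j + a i ∈ T) (hβ : β ≠ c) :
    IsFamily x d a β (insert c T)
      (Function.update ψ c (algebraMap ℂ R (β - c)⁻¹ • ∑ i, a i • x i • ψ (c + a i))) := by
  have hne : ∀ i, c + a i ≠ c := fun i => by have := ha i; omega
  have hb : β - c ≠ 0 := sub_ne_zero.2 hβ
  constructor
  · rintro j (rfl | hj) i
    · rw [Function.update_self, Function.update_of_ne (hne i), ← mul_smul,
        ← Algebra.commutes, mul_smul, Finset.smul_sum]
      have e : ∀ k, d i • a k • x k • ψ (j + a k) =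
          (if i = k then a k • ψ (j + a k) else 0) + a k • x k • ψ (j + a i + a k) := by
        intro k
        rw [smul_comm, ← mul_smul, hR.leibniz, add_smul, mul_smul, h.partial_smul _ (hT k),
          add_right_comm j, smul_add, add_comm]
        split_ifs <;> simp
      rw [Finset.sum_congr rfl fun k _ => e k, Finset.sum_add_distrib, h.euler _ (hT i),
        Finset.sum_ite_eq]
      simp only [Finset.mem_univ, if_true]
      have e2 : a i • ψ (j + a i) = algebraMap ℂ R (a i) • ψ (j + a i) := by
        rw [map_natCast, Nat.cast_smul_eq_nsmul]
      rw [e2, ← add_smul, ← map_add, ← mul_smul, ← map_mul]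
      have : (β - j)⁻¹ * ((a i : ℂ) + (β - ((j + a i : ℕ) : ℂ))) = 1 := by
        push_cast
        field_simp
        ring
      rw [this, map_one, one_smul]
    · rw [Function.update_of_ne (ne_of_mem_of_not_mem hj hc),
        Function.update_of_ne (ne_of_mem_of_not_mem (hT' j hj i) hc), h.partial_smul j hj]
  · rintro j (rfl | hj)
    · rw [Function.update_self, ← mul_smul, ← map_mul, mul_inv_cancel₀ hb, map_one, one_smul]
      exact Finset.sum_congr rfl fun i _ => by rw [Function.update_of_ne (hne i)]
    · rw [Function.update_of_ne (ne_of_mem_of_not_mem hj hc), ← h.euler j hj]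
      exact Finset.sum_congr rfl fun i _ => by
        rw [Function.update_of_ne (ne_of_mem_of_not_mem (hT' j hj i) hc)]

/-- A family over a cofinite set of indices stable under the shifts by the `aᵢ` extends to all
indices, if `β` is not one of the missing ones. -/
theorem IsFamily.exists_extend (hR : WeylRel x d) (h : IsFamily x d a β T ψ)
    (ha : ∀ i, 0 < a i) (hT' : ∀ j ∈ T, ∀ i, j + a i ∈ T) {c : ℕ} (hc : ∀ j, c ≤ j → j ∈ T)
    (hβ : ∀ j : ℕ, j ∉ T → β ≠ j) :
    ∃ φ : ℕ → M, IsFamily x d a β Set.univ φ ∧ ∀ j ∈ T, φ j = ψ j := by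
  -- Gaps are filled from the top: when `c` is treated, every index above `c` is already in `T`, in
  -- particular all `c + aᵢ`.
  induction c generalizing T ψ with
  | zero =>
    have : T = Set.univ := Set.eq_univ_of_forall fun j => hc j (Nat.zero_le j)
    exact ⟨ψ, this ▸ h, fun _ _ => rfl⟩
  | succ c ih =>
    by_cases hcT : c ∈ T
    · exact ih h hT' (fun j hj => (Nat.eq_or_lt_of_le hj).elim (fun e => e ▸ hcT) (hc j)) hβ
    · have hcs : ∀ i, c + a i ∈ T := fun i => hc _ (by have := ha i; omega)
      obtain ⟨φ, hφ, hφ'⟩ := ih (h.extend_insert hR hcT ha hcs hT' (hβ c hcT))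
        (by
          rintro j (rfl | hj) i
          · exact Or.inr (hcs i)
          · exact Or.inr (hT' j hj i))
        (fun j hj => (Nat.eq_or_lt_of_le hj).elim (fun e => Or.inl e.symm) fun h => Or.inr (hc j h))
        (fun j hj => hβ j fun hjT => hj (Or.inr hjT))
      refine ⟨φ, hφ, fun j hj => ?_⟩
      rw [hφ' j (Or.inr hj), Function.update_of_ne (ne_of_mem_of_not_mem hj hcT)]

/-- A family is determined by its members with indices in a cofinite set, if `β` is not one of the
missing indices. -/
theorem IsFamily.ext {φ : ℕ → M} (h : IsFamily x d a β Set.univ ψ)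
    (h' : IsFamily x d a β Set.univ φ) (ha : ∀ i, 0 < a i) {c : ℕ} (hc : ∀ j, c ≤ j → j ∈ T)
    (hβ : ∀ j : ℕ, j ∉ T → β ≠ j) (hT : ∀ j ∈ T, ψ j = φ j) (j : ℕ) : ψ j = φ j := by
  induction c generalizing T with
  | zero => exact hT j (hc j (Nat.zero_le j))
  | succ c ih =>
    have hcc : ψ c = φ c := by
      by_cases hcT : c ∈ T
      · exact hT c hcT
      · have hb : β - c ≠ 0 := sub_ne_zero.2 (hβ c hcT)
        -- The Euler relation expresses `(β - c) ψ_c` through members of index larger than `c`,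
        -- where the families already agree.
        have e : algebraMap ℂ R (β - c) • ψ c = algebraMap ℂ R (β - c) • φ c := by
          rw [← h.euler c trivial, ← h'.euler c trivial]
          exact Finset.sum_congr rfl fun i _ => by
            rw [hT _ (hc (c + a i) (by have := ha i; omega))]
        have e' := congrArg (algebraMap ℂ R (β - c)⁻¹ • ·) e
        simpa only [← mul_smul, ← map_mul, inv_mul_cancel₀ hb, map_one, one_smul] using e'
    refine ih (T := insert c T)
      (fun j hj => (Nat.eq_or_lt_of_le hj).elim (fun e => Or.inl e.symm) fun h => Or.inr (hc j h))
      (fun j hj => hβ j fun hjT => hj (Or.inr hjT)) ?_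
    rintro j (rfl | hj)
    · exact hcc
    · exact hT j hj

theorem IsFamily.map {M' : Type*} [AddCommGroup M'] [Module R M'] (f : M →ₗ[R] M')
    (h : IsFamily x d a β T ψ) : IsFamily x d a β T fun j => f (ψ j) := by
  constructor
  · intro j hj i
    rw [← map_smul, h.partial_smul j hj]
  · intro j hj
    rw [← map_smul, ← h.euler j hj, map_sum]
    simp only [map_nsmul, map_smul]

/-- Given the shift relations, this is the Euler relation in its usual form. The structure
`IsFamily` states it without the `∂ᵢ`, so that it can serve to define a missing member from later
ones. -/
theorem IsFamily.of_eulerSum (h : ∀ j ∈ T, ∀ i, d i • ψ j = ψ (j + a i))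
    (hE : ∀ j ∈ T, eulerSum x d a • ψ j = algebraMap ℂ R (β - j) • ψ j) :
    IsFamily x d a β T ψ where
  partial_smul := h
  euler j hj := by
    rw [← hE j hj, eulerSum, Finset.sum_smul]
    refine Finset.sum_congr rfl fun i _ => ?_
    rw [smul_assoc, mul_smul, h j hj]

theorem IsFamily.eulerSum_smul (h : IsFamily x d a β T ψ) {j : ℕ} (hj : j ∈ T) :
    eulerSum x d a • ψ j = algebraMap ℂ R (β - j) • ψ j := by
  rw [← h.euler j hj, eulerSum, Finset.sum_smul]
  refine Finset.sum_congr rfl fun i _ => ?_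
  rw [smul_assoc, mul_smul, h.partial_smul j hj]

/-- Shifting the indices upwards. -/
theorem IsFamily.shift_right (h : IsFamily x d a β Set.univ ψ) (m : ℕ) :
    IsFamily x d a (β + m) (Set.Ici m) fun j => ψ (j - m) := by
  -- Below `m` truncated subtraction only repeats `ψ 0`, so the relations are claimed from `m` on.
  constructor
  · intro j hj i
    rw [h.partial_smul _ trivial, ← Nat.sub_add_comm hj]
  · intro j hj
    have h1 := h.euler (j - m) trivial
    have e : β - ((j - m : ℕ) : ℂ) = β + m - j := by
      rw [Nat.cast_sub hj]
      ring
    rw [e] at h1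
    rw [← h1]
    exact Finset.sum_congr rfl fun i _ => by rw [← Nat.sub_add_comm hj]

/-- Shifting the indices downwards. -/
theorem IsFamily.shift_left {m : ℕ} (h : IsFamily x d a (β + m) Set.univ ψ) :
    IsFamily x d a β Set.univ fun j => ψ (j + m) := by
  constructor
  · intro j _ i
    rw [h.partial_smul _ trivial, add_right_comm]
  · intro j _
    have h1 := h.euler (j + m) trivial
    have e : β + m - ((j + m : ℕ) : ℂ) = β - j := by
      push_cast
      ring
    rw [e] at h1
    rw [← h1]
    exact Finset.sum_congr rfl fun i _ => by rw [add_right_comm]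

/-- Moving the Euler operator past `∂ᵘ` changes its eigenvalue on `∂ᵘ v` from `β` to `β - ∑ uᵢ aᵢ`.
Thus vectors `∂ᵘ v` that depend only on the degree form a family over the semigroup. -/
theorem WeylRel.isFamily_of_ordPow (hR : WeylRel x d) {v : M}
    (hv : eulerSum x d a • v = algebraMap ℂ R β • v)
    (hψ : ∀ u : Fin n → ℕ, ordPow d u • v = ψ (∑ i, u i * a i)) :
    IsFamily x d a β (Set.range fun u : Fin n → ℕ => ∑ i, u i * a i) ψ := by
  refine .of_eulerSum ?_ ?_
  · rintro _ ⟨u, rfl⟩ i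
    have : ∑ k, u k * a k + a i = ∑ k, (u + Pi.single i 1 : Fin n → ℕ) k * a k := by
      simp [add_mul, Finset.sum_add_distrib, Pi.single_apply]
    rw [this, ← hψ, ← hψ, add_comm u, ordPow_add hR.comm, ordPow_single, pow_one, mul_smul]
  · rintro _ ⟨u, rfl⟩
    have h2 := congrArg (· • v) (ordPow_mul_of_shift (fun i => hR.mul_eulerSum (a := a) i) u)
    simp only [mul_smul, add_smul, hv] at h2
    rw [← mul_smul, ← Algebra.commutes, mul_smul, hψ] at h2
    rw [map_sub, sub_smul, h2, map_natCast]
    simp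

end Family

/-! ### Division of holomorphic functions by `x₀` -/

/-- Averaging an analytic function over a path of linear contractions gives an analytic
function. -/
theorem analyticAt_integral_contraction {E : Type*} [NormedAddCommGroup E] [NormedSpace ℂ E]
    {F : E → ℂ} {q : E} (hF : AnalyticAt ℂ F q) {L : ℝ → E →L[ℂ] E} (hL : Continuous L)
    (hL1 : ∀ t ∈ Set.uIoc (0 : ℝ) 1, ‖L t‖ ≤ 1) :
    AnalyticAt ℂ (fun y => ∫ t in (0 : ℝ)..1, F (q + L t (y - q))) q := by
  obtain ⟨P, r, hP⟩ := hF
  have hcont : ∀ m, Continuous fun t => (P m).compContinuousLinearMap fun _ => L t := fun m =>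
    ((P m).compContinuousLinearMapLRight (E := fun _ : Fin m => E)).cont.comp
      (continuous_pi fun _ => hL)
  -- The average is expanded term by term. Since `‖L t‖ ≤ 1`, its coefficients are bounded by those
  -- of `P`, so the radius of convergence does not shrink.
  let Q : FormalMultilinearSeries ℂ E ℂ := fun m =>
    ∫ t in (0 : ℝ)..1, (P m).compContinuousLinearMap fun _ => L t
  have hpow : ∀ (m : ℕ), ∀ t ∈ Set.uIoc (0 : ℝ) 1, ∏ _i : Fin m, ‖L t‖ ≤ 1 := fun m t ht =>
    Finset.prod_le_one (fun _ _ => norm_nonneg _) fun _ _ => hL1 t ht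
  have hQ : ∀ m, ‖Q m‖ ≤ ‖P m‖ := by
    intro m
    have := intervalIntegral.norm_integral_le_of_norm_le_const
      (f := fun t => (P m).compContinuousLinearMap fun _ => L t) (C := ‖P m‖) (a := 0) (b := 1)
      fun t ht => ((P m).norm_compContinuousLinearMap_le _).trans
        (mul_le_of_le_one_right (norm_nonneg _) (hpow m t ht))
    simpa using this
  have hrad : P.radius ≤ Q.radius := by
    refine ENNReal.le_of_forall_nnreal_lt fun s hs => ?_
    obtain ⟨C, _, hC⟩ := P.norm_mul_pow_le_of_lt_radius hs
    exact Q.le_radius_of_bound C fun m =>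
      (mul_le_mul_of_nonneg_right (hQ m) (by positivity)).trans (hC m)
  refine ⟨Q, r, hP.r_le.trans hrad, hP.r_pos, fun {y} hy => ?_⟩
  have hyr : (‖y‖₊ : ENNReal) < P.radius := by
    have h1 : y ∈ Metric.eball (0 : E) r := hy
    rw [mem_eball_zero_iff] at h1
    exact lt_of_lt_of_le h1 hP.r_le
  have hLy : ∀ t ∈ Set.uIoc (0 : ℝ) 1, ‖L t y‖ ≤ ‖y‖ := fun t ht =>
    ((L t).le_opNorm y).trans (mul_le_of_le_one_left (norm_nonneg _) (hL1 t ht))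
  have hsum := P.summable_norm_mul_pow hyr
  have hQapply : ∀ m, Q m (fun _ => y) = ∫ t in (0 : ℝ)..1, P m fun _ => L t y := by
    intro m
    exact ((ContinuousMultilinearMap.apply ℂ (fun _ : Fin m => E) ℂ
      (fun _ => y)).intervalIntegral_comp_comm ((hcont m).intervalIntegrable 0 1)).symm
  simp only [hQapply, add_sub_cancel_left]
  refine intervalIntegral.hasSum_integral_of_dominated_convergence
    (fun m _ => ‖P m‖ * (‖y‖₊ : ℝ) ^ m) (fun m => ?_) (fun m => ?_) ?_ ?_ ?_
  · refine Continuous.aestronglyMeasurable ?_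
    exact (P m).cont.comp (continuous_pi fun _ => hL.clm_apply continuous_const)
  · refine .of_forall fun t ht => ((P m).le_opNorm _).trans ?_
    refine mul_le_mul_of_nonneg_left ?_ (norm_nonneg _)
    simpa using pow_le_pow_left₀ (norm_nonneg _) (hLy t ht) m
  · exact .of_forall fun t _ => hsum
  · exact intervalIntegrable_const
  · refine .of_forall fun t ht => hP.hasSum ?_
    rw [mem_eball_zero_iff] at hy ⊢
    refine lt_of_le_of_lt ?_ hy
    exact ENNReal.coe_le_coe.2 (hLy t ht)

/-- Scaling of the coordinate `x₀` by `t`. -/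
def scaleL (n : ℕ) (t : ℝ) : (Fin (n + 1) → ℂ) →L[ℂ] (Fin (n + 1) → ℂ) :=
  (inclL n).comp (tailL n) + (t : ℂ) •
    (ContinuousLinearMap.proj (R := ℂ) (φ := fun _ : Fin (n + 1) => ℂ) 0).smulRight (Pi.single 0 1)

theorem scaleL_apply {n : ℕ} (t : ℝ) (y : Fin (n + 1) → ℂ) :
    scaleL n t y = incl (Fin.tail y) + ((t : ℂ) * y 0) • Pi.single 0 1 := by
  simp [scaleL, inclL_apply, mul_smul]
  rfl

theorem scaleL_apply' {n : ℕ} (t : ℝ) (y : Fin (n + 1) → ℂ) :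
    scaleL n t y = Fin.cons ((t : ℂ) * y 0) (Fin.tail y) := by
  rw [scaleL_apply]
  ext j
  refine Fin.cases ?_ (fun j => ?_) j <;> simp [incl]

theorem norm_scaleL_le {n : ℕ} {t : ℝ} (ht : t ∈ Set.Icc (0 : ℝ) 1) : ‖scaleL n t‖ ≤ 1 := by
  refine ContinuousLinearMap.opNorm_le_bound _ zero_le_one fun y => ?_
  rw [one_mul, pi_norm_le_iff_of_nonneg (norm_nonneg _), scaleL_apply']
  intro j
  refine Fin.cases ?_ (fun j => ?_) j
  · rw [Fin.cons_zero, norm_mul, Complex.norm_real, Real.norm_eq_abs, abs_of_nonneg ht.1]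
    exact (mul_le_of_le_one_left (norm_nonneg _) ht.2).trans (norm_le_pi_norm y 0)
  · exact norm_le_pi_norm y j.succ

/-- A holomorphic function differs from its restriction to `x₀ = 0` by a multiple of `x₀`. -/
theorem exists_eq_pull_add_coord_mul {n : ℕ} {p : Fin n → ℂ} {g : (Fin (n + 1) → ℂ) → ℂ}
    (hg : AnalyticAt ℂ g (incl p)) :
    ∃ h, AnalyticAt ℂ h (incl p) ∧
      g =ᶠ[𝓝 (incl p)] fun y => pull (g ∘ incl) y + y 0 * h y := by
  have hfix : ∀ t, scaleL n t (incl p) = incl p := fun t => by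
    rw [scaleL_apply, tail_incl]
    simp [incl]
  have hIcc : Set.uIcc (0 : ℝ) 1 = Set.Icc 0 1 := Set.uIcc_of_le zero_le_one
  -- The quotient is `h(y) = ∫₀¹ (∂₀g)(t y₀, y₁, …, yₙ) dt`: integrating the derivative of `t ↦ g(t
  -- y₀, y₁, …, yₙ)`, which is `y₀ ∂₀g`, over `[0, 1]` gives `g(y) - g(0, y₁, …, yₙ)`.
  refine ⟨_, analyticAt_integral_contraction (analyticAt_pderiv 0 hg) (L := scaleL n)
    (by unfold scaleL; fun_prop) (fun t ht => norm_scaleL_le (hIcc ▸ Set.uIoc_subset_uIcc ht)), ?_⟩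
  obtain ⟨r, hr, hB⟩ := Metric.eventually_nhds_iff_ball.1 hg.eventually_analyticAt
  filter_upwards [Metric.ball_mem_nhds _ hr] with y hy
  have hpt : ∀ t, incl p + scaleL n t (y - incl p) = scaleL n t y := fun t => by
    rw [map_sub, hfix, add_sub_cancel]
  have hmem : ∀ t ∈ Set.uIcc (0 : ℝ) 1, scaleL n t y ∈ Metric.ball (incl p) r := by
    intro t ht
    rw [← hpt, mem_ball_iff_norm, add_sub_cancel_left]
    refine lt_of_le_of_lt (((scaleL n t).le_opNorm _).trans
      (mul_le_of_le_one_left (norm_nonneg _) (norm_scaleL_le (hIcc ▸ ht)))) ?_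
    rwa [← mem_ball_iff_norm]
  have hline : ∀ t : ℝ, HasDerivAt (fun t => scaleL n t y) (y 0 • Pi.single 0 1) t := by
    intro t
    simp only [scaleL_apply]
    refine HasDerivAt.const_add _ (HasDerivAt.smul_const ?_ _)
    simpa using (Complex.ofRealCLM.hasDerivAt (x := t)).mul_const (y 0)
  have hder : ∀ t ∈ Set.uIcc (0 : ℝ) 1, HasDerivAt (fun t : ℝ => g (scaleL n t y))
      (y 0 * pderiv 0 g (scaleL n t y)) t := by
    intro t ht
    have h1 := ((hB _ (hmem t ht)).differentiableAt.hasFDerivAt.restrictScalars ℝ).comp_hasDerivAt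
      t (hline t)
    simpa [pderiv, Function.comp_def] using h1
  have hint : IntervalIntegrable (fun t : ℝ => y 0 * pderiv 0 g (scaleL n t y))
      MeasureTheory.volume 0 1 := by
    refine ContinuousOn.intervalIntegrable fun t ht => ContinuousAt.continuousWithinAt ?_
    exact continuousAt_const.mul (ContinuousAt.comp (g := pderiv 0 g) (f := fun t => scaleL n t y)
      (analyticAt_pderiv 0 (hB _ (hmem t ht))).continuousAt (hline t).continuousAt)
  have := intervalIntegral.integral_eq_sub_of_hasDerivAt hder hint
  rw [intervalIntegral.integral_const_mul] at this
  simp only [hpt, this, pull, Function.comp_apply]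
  have e1 : scaleL n 1 y = y := by
    rw [scaleL_apply']
    simp
  have e0 : scaleL n 0 y = incl (Fin.tail y) := by
    rw [scaleL_apply']
    simp [incl]
  rw [e1, e0]
  ring

/-! ### Relations in the ring of differential operators -/

theorem mulD_congr {n : ℕ} {p : Fin n → ℂ} {f g : (Fin n → ℂ) → ℂ} (hf : AnalyticAt ℂ f p)
    (hg : AnalyticAt ℂ g p) (h : f =ᶠ[𝓝 p] g) : mulD f hf = mulD g hg := by
  refine Subtype.ext (LinearMap.ext fun φ => Subtype.ext ?_)
  exact congrArg (· * φ.1) (Germ.coe_eq.2 h)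

theorem mulD_add {n : ℕ} {p : Fin n → ℂ} {f g : (Fin n → ℂ) → ℂ} (hf : AnalyticAt ℂ f p)
    (hg : AnalyticAt ℂ g p) : mulD (fun y => f y + g y) (hf.add hg) = mulD f hf + mulD g hg :=
  Subtype.ext (LinearMap.ext fun φ => Subtype.ext (add_mul (f : Germ (𝓝 p) ℂ) g φ.1))

theorem mulD_mul {n : ℕ} {p : Fin n → ℂ} {f g : (Fin n → ℂ) → ℂ} (hf : AnalyticAt ℂ f p)
    (hg : AnalyticAt ℂ g p) : mulD (fun y => f y * g y) (hf.mul hg) = mulD f hf * mulD g hg :=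
  Subtype.ext (LinearMap.ext fun φ => Subtype.ext (mul_assoc (f : Germ (𝓝 p) ℂ) g φ.1))

theorem mulD_const {n : ℕ} {p : Fin n → ℂ} (c : ℂ) :
    mulD (fun _ => c) (analyticAt_const (x := p)) = algebraMap ℂ (DStalk p) c := by
  refine Subtype.ext (LinearMap.ext fun φ => ?_)
  induction φ using HolGerm.ind with
  | h φ hφ => rfl

theorem partialD_mul_mulD {n : ℕ} {p : Fin n → ℂ} (i : Fin n) {f : (Fin n → ℂ) → ℂ}
    (hf : AnalyticAt ℂ f p) :
    partialD i * mulD f hf =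
      mulD f hf * partialD i + mulD (pderiv i f) (analyticAt_pderiv i hf) := by
  refine Subtype.ext (LinearMap.ext fun g => ?_)
  induction g using HolGerm.ind with
  | h g hg =>
    refine holGerm_eq_iff (hf := analyticAt_pderiv i (hf.mul hg))
      (hg := (hf.mul (analyticAt_pderiv i hg)).add ((analyticAt_pderiv i hf).mul hg)).2 ?_
    filter_upwards [hf.eventually_analyticAt, hg.eventually_analyticAt] with x h1 h2
    simp [pderiv, fderiv_mul h1.differentiableAt h2.differentiableAt, mul_comm]

theorem commute_partialD {n : ℕ} {p : Fin n → ℂ} (i j : Fin n) :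
    Commute (partialD i : DStalk p) (partialD j) :=
  Subtype.ext (partialOp_comm i j)

theorem pderiv_coord {n : ℕ} (i j : Fin n) :
    pderiv i (fun x => x j) = fun _ => if i = j then (1 : ℂ) else 0 := by
  ext x
  have h1 : fderiv ℂ (fun x : Fin n → ℂ => x j) x =
      ContinuousLinearMap.proj (R := ℂ) (φ := fun _ : Fin n => ℂ) j :=
    (ContinuousLinearMap.proj (R := ℂ) (φ := fun _ : Fin n => ℂ) j).fderiv
  simp [pderiv, h1, Pi.single_apply, eq_comm]

theorem weylRel_DStalk {n : ℕ} (p : Fin n → ℂ) :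
    WeylRel (fun i => (coordD i : DStalk p)) (fun i => partialD i) where
  comm := commute_partialD
  leibniz i j := by
    refine (partialD_mul_mulD i (analyticAt_coord j p)).trans
      (congrArg (coordD j * partialD i + ·) ?_)
    rw [mulD_congr _ (analyticAt_const (v := if i = j then (1 : ℂ) else 0))
      (by rw [pderiv_coord]), mulD_const]
    split_ifs <;> simp

/-- Every differential operator at `p` is the germ of a section. -/
theorem exists_basicSection {n : ℕ} {p : Fin n → ℂ} (P : DStalk p) :
    ∃ (U : Opens (X n)) (hp : p ∈ U), ∃ s ∈ basicSections U, s ⟨p, hp⟩ = P := by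
  obtain ⟨T, hT⟩ := P
  induction hT using Algebra.adjoin_induction with
  | mem T hT =>
    obtain ⟨f, hf, rfl⟩ | ⟨i, rfl⟩ := hT
    · obtain ⟨V, hV, hVo, hpV⟩ := eventually_nhds_iff.1 hf.eventually_analyticAt
      exact ⟨⟨V, hVo⟩, hpV, mulSec _ f hV, Algebra.subset_adjoin (Or.inl ⟨f, hV, rfl⟩), rfl⟩
    · exact ⟨⊤, trivial, _, Algebra.subset_adjoin (Or.inr ⟨i, rfl⟩), rfl⟩
  | algebraMap r => exact ⟨⊤, trivial, _, (basicSections ⊤).algebraMap_mem r, rfl⟩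
  | add S T hS hT h1 h2 =>
    obtain ⟨U, hpU, s, hs, e⟩ := h1
    obtain ⟨V, hpV, t, ht, e'⟩ := h2
    exact ⟨U ⊓ V, ⟨hpU, hpV⟩, _, (basicSections _).add_mem
      (basicSections_res (Opens.infLELeft U V) hs) (basicSections_res (Opens.infLERight U V) ht),
      congrArg₂ (· + ·) e e'⟩
  | mul S T hS hT h1 h2 =>
    obtain ⟨U, hpU, s, hs, e⟩ := h1
    obtain ⟨V, hpV, t, ht, e'⟩ := h2
    exact ⟨U ⊓ V, ⟨hpU, hpV⟩, _, (basicSections _).mul_mem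
      (basicSections_res (Opens.infLELeft U V) hs) (basicSections_res (Opens.infLERight U V) ht),
      congrArg₂ (· * ·) e e'⟩

/-! ### Operators modulo `x₀ 𝒟` -/

/-- The stalk at `(0, p)` of `x₀ 𝒟`. -/
def coordIdeal {n : ℕ} (p : Fin n → ℂ) : Submodule (DStalk p) (DStalk (incl p)) where
  carrier := {P | ∃ R, P = coordD 0 * R}
  zero_mem' := ⟨0, (mul_zero _).symm⟩
  add_mem' := by
    rintro _ _ ⟨R, rfl⟩ ⟨R', rfl⟩
    exact ⟨R + R', (mul_add _ _ _).symm⟩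
  smul_mem' := by
    rintro P _ ⟨R, rfl⟩
    exact ⟨liftD p P * R, by rw [lift_smul_def, ← mul_assoc, liftD_coordD, mul_assoc]⟩

theorem mul_mem_coordIdeal {n : ℕ} {p : Fin n → ℂ} {P : DStalk (incl p)} (hP : P ∈ coordIdeal p)
    (Q : DStalk (incl p)) : P * Q ∈ coordIdeal p := by
  obtain ⟨R, rfl⟩ := hP
  exact ⟨R * Q, mul_assoc _ _ _⟩

/-- The families of operators along the hyperplane that are combinations of the `∂₀ᵏ`, with
coefficients sections of `𝒟`, modulo `x₀ 𝒟`. -/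
def decompSections {n : ℕ} (U : Opens (X n)) :
    Submodule (basicSections U) (∀ x : U, DStalk (incl (x.1 : Fin n → ℂ))) :=
  Submodule.span (basicSections U) (Set.range fun (k : ℕ) (_ : U) => partialD 0 ^ k) ⊔
    { carrier := {Q | ∀ x, Q x ∈ coordIdeal x.1}
      zero_mem' := fun x => (coordIdeal x.1).zero_mem
      add_mem' := fun hP hQ x => (coordIdeal x.1).add_mem (hP x) (hQ x)
      smul_mem' := fun P _ hQ x => (coordIdeal x.1).smul_mem (P.1 x) (hQ x) }

theorem decompSections_pow_mem {n : ℕ} (U : Opens (X n)) (k : ℕ) :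
    (fun _ => partialD 0 ^ k) ∈ decompSections U :=
  Submodule.mem_sup_left (Submodule.subset_span ⟨k, rfl⟩)

/-- Right multiplication by `r` is linear for the action by left multiplication and preserves `x₀
𝒟`, so it suffices to test it on the generators `∂₀ᵏ`. -/
theorem decompSections_mul_mem {n : ℕ} {U : Opens (X n)}
    {Q r : ∀ x : U, DStalk (incl (x.1 : Fin n → ℂ))}
    (hr : ∀ k : ℕ, (fun x => partialD 0 ^ k * r x) ∈ decompSections U)
    (hQ : Q ∈ decompSections U) : Q * r ∈ decompSections U := by
  obtain ⟨Q₁, h₁, Q₂, h₂, rfl⟩ := Submodule.mem_sup.1 hQ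
  rw [add_mul]
  refine Submodule.add_mem _ ?_ (Submodule.mem_sup_right fun x => mul_mem_coordIdeal (h₂ x) _)
  clear hQ
  induction h₁ using Submodule.span_induction with
  | mem Q hQ =>
    obtain ⟨k, rfl⟩ := hQ
    exact hr k
  | zero => rw [zero_mul]; exact Submodule.zero_mem _
  | add P Q _ _ hP hQ =>
    rw [add_mul]
    exact Submodule.add_mem _ hP hQ
  | smul s Q _ hQ =>
    have e : (s • Q) * r = s • (Q * r) := by
      ext1 x
      exact mul_assoc (liftD x.1 (s.1 x)) (Q x) (r x)
    rw [e]
    exact Submodule.smul_mem _ _ hQ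

/-- For `k = 0` this is division by `x₀`. For larger `k`, commuting one `∂₀` past `f` leaves
`∂₀^{k-1} f ∂₀` and `∂₀^{k-1} (∂₀f)`, both covered by the induction over all `f`. -/
theorem decompSections_pow_mul_mulD_mem {n : ℕ} {U : Opens (X n)} (k : ℕ)
    {f : (Fin (n + 1) → ℂ) → ℂ} (hf : ∀ x : U, AnalyticAt ℂ f (incl x.1)) :
    (fun x => partialD 0 ^ k * mulD f (hf x)) ∈ decompSections U := by
  induction k generalizing f with
  | zero =>
    have hs : ∀ x ∈ U, AnalyticAt ℂ (f ∘ incl) x := fun x hx =>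
      (hf ⟨x, hx⟩).comp (analyticAt_incl x)
    let s : basicSections U :=
      ⟨mulSec U (f ∘ incl) hs, Algebra.subset_adjoin (Or.inl ⟨_, hs, rfl⟩)⟩
    have h1 := Submodule.smul_mem _ s (decompSections_pow_mem U 0)
    rw [← Submodule.sub_mem_iff_left _ h1]
    refine Submodule.mem_sup_right fun x => ?_
    obtain ⟨h, hh, e⟩ := exists_eq_pull_add_coord_mul (hf x)
    refine ⟨mulD h hh, ?_⟩
    change partialD 0 ^ 0 * mulD f (hf x) -
      liftD x.1 (mulD (f ∘ incl) (hs x.1 x.2)) * partialD 0 ^ 0 = _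
    rw [pow_zero, one_mul, mul_one, liftD_mulD, mulD_congr (hf x)
      ((analyticAt_pull_incl (hs x.1 x.2)).add ((analyticAt_coord 0 _).mul hh)) e]
    refine sub_eq_of_eq_add' (Eq.trans (mulD_add
      (analyticAt_pull_incl (hs x.1 x.2)) ((analyticAt_coord 0 _).mul hh)) ?_)
    exact congrArg (_ + ·) (mulD_mul _ hh)
  | succ k ih =>
    have e : (fun x : U => partialD 0 ^ (k + 1) * mulD f (hf x)) =
        (fun x : U => partialD 0 ^ k * mulD f (hf x)) * (fun _ => partialD 0) +
          fun x : U => partialD 0 ^ k * mulD (pderiv 0 f) (analyticAt_pderiv 0 (hf x)) := by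
      ext1 x
      change partialD 0 ^ (k + 1) * mulD f (hf x) = partialD 0 ^ k * mulD f (hf x) * partialD 0 + _
      rw [pow_succ, mul_assoc, partialD_mul_mulD, mul_add, mul_assoc]
    rw [e]
    refine Submodule.add_mem _ (decompSections_mul_mem (fun k => ?_) (ih hf)) (ih _)
    simp only [← pow_succ]
    exact decompSections_pow_mem U (k + 1)

/-- Modulo `x₀ 𝒟`, sections of `𝒟` on `ℂⁿ⁺¹` are combinations of the `∂₀ᵏ` along the hyperplane,
with coefficients sections of `𝒟` on `ℂⁿ`. -/
theorem basicSections_mem_decompSections {n : ℕ} {U : Opens (X n)} {W : Opens (X (n + 1))}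
    (hW : ∀ x ∈ U, incl x ∈ W) {P : ∀ y : W, DStalk (y.1 : Fin (n + 1) → ℂ)}
    (hP : P ∈ basicSections W) :
    (fun x : U => P ⟨incl x.1, hW x.1 x.2⟩) ∈ decompSections U := by
  -- The set of decomposable families is not visibly closed under products. Stability under right
  -- multiplication by `P` is, which lets the induction on generators pass through products.
  suffices h : ∀ Q ∈ decompSections U,
      Q * (fun x : U => P ⟨incl x.1, hW x.1 x.2⟩) ∈ decompSections U by
    have := h _ (decompSections_pow_mem U 0)
    simp only [pow_zero] at this
    rwa [← Pi.one_def, one_mul] at this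
  induction hP using Algebra.adjoin_induction with
  | mem P hP =>
    intro Q hQ
    refine decompSections_mul_mem (fun k => ?_) hQ
    obtain ⟨f, hf, rfl⟩ | ⟨i, rfl⟩ := hP
    · exact decompSections_pow_mul_mulD_mem k fun x => hf _ (hW x.1 x.2)
    · refine Fin.cases ?_ (fun i => ?_) i
      · simp only [← pow_succ]
        exact decompSections_pow_mem U (k + 1)
      · let s : basicSections U := ⟨fun _ => partialD i, Algebra.subset_adjoin (Or.inr ⟨i, rfl⟩)⟩
        have e : (fun x : U => (partialD 0 ^ k * partialD i.succ : DStalk (incl x.1))) =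
            s • fun _ => partialD 0 ^ k := by
          ext1 x
          change _ = liftD x.1 (partialD i) * partialD 0 ^ k
          rw [liftD_partialD]
          exact (commute_partialD _ _).pow_left k
        rw [e]
        exact Submodule.smul_mem _ s (decompSections_pow_mem U k)
  | algebraMap r =>
    intro Q hQ
    have e : (Q * fun x : U => algebraMap ℂ (DStalk (incl x.1)) r) =
        algebraMap ℂ (basicSections U) r • Q := by
      ext1 x
      change Q x * algebraMap ℂ (DStalk (incl x.1)) r = liftD x.1 (algebraMap ℂ _ r) * Q x
      rw [AlgHom.commutes, Algebra.commutes]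
    exact e ▸ Submodule.smul_mem _ _ hQ
  | add P P' _ _ hP hP' =>
    intro Q hQ
    have := Submodule.add_mem _ (hP Q hQ) (hP' Q hQ)
    rwa [← mul_add] at this
  | mul P P' _ _ hP hP' =>
    intro Q hQ
    have := hP' _ (hP Q hQ)
    rwa [mul_assoc] at this

theorem exists_finsupp_of_mem_decompSections {n : ℕ} {U : Opens (X n)}
    {Q : ∀ x : U, DStalk (incl (x.1 : Fin n → ℂ))} (hQ : Q ∈ decompSections U) :
    ∃ c : ℕ →₀ basicSections U, ∀ x : U,
      Q x - c.sum (fun k s => s.1 x • (partialD 0 ^ k : DStalk (incl x.1))) ∈ coordIdeal x.1 := by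
  obtain ⟨Q₁, h₁, Q₂, h₂, rfl⟩ := Submodule.mem_sup.1 hQ
  obtain ⟨c, rfl⟩ := (Finsupp.mem_span_range_iff_exists_finsupp).1 h₁
  refine ⟨c, fun x => ?_⟩
  convert h₂ x using 1
  rw [Pi.add_apply, Finsupp.sum, Finsupp.sum, Finset.sum_apply]
  exact add_sub_cancel_left _ _

/-- The combinations `∑ Pₖ ∂₀ᵏ` with coefficients in `𝒟_{ℂⁿ,p}`. -/
def partialComb {n : ℕ} (p : Fin n → ℂ) : (ℕ →₀ DStalk p) →ₗ[DStalk p] DStalk (incl p) :=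
  Finsupp.linearCombination (DStalk p) fun k => partialD 0 ^ k

theorem exists_sub_partialComb_mem {n : ℕ} {p : Fin n → ℂ} (P : DStalk (incl p)) :
    ∃ c, P - partialComb p c ∈ coordIdeal p := by
  -- The germ is spread out to a section, decomposed there, and the coefficients are evaluated at
  -- `p`.
  obtain ⟨W, hp, s, hs, rfl⟩ := exists_basicSection P
  let U : Opens (X n) := ⟨{x | incl x ∈ W}, W.2.preimage continuous_incl⟩
  obtain ⟨c, hc⟩ := exists_finsupp_of_mem_decompSections
    (basicSections_mem_decompSections (U := U) (fun x hx => hx) hs)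
  refine ⟨c.mapRange (fun t => t.1 ⟨p, hp⟩) rfl, ?_⟩
  convert hc ⟨p, hp⟩ using 2
  rw [partialComb, Finsupp.linearCombination_apply, Finsupp.sum_mapRange_index (by simp)]

/-! ### Independence of the powers of `∂₀` modulo `x₀ 𝒟` -/

theorem restrGerm_liftD {n : ℕ} {p : Fin n → ℂ} (S : DStalk p) (g : HolGerm (incl p)) :
    restrGerm p ((liftD p S).1 g) = S.1 (restrGerm p g) := by
  obtain ⟨⟨⟨T, S⟩, hT⟩, rfl⟩ := (liftGraph_snd_bijective p).2 S
  change restrGerm p ((liftD p S).1 g) = S.1 (restrGerm p g)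
  rw [liftD_eq hT]
  exact liftGraph_spec hT 0 g

theorem analyticAt_coord_pow {n : ℕ} (j : ℕ) (p : Fin n → ℂ) (i : Fin n) :
    AnalyticAt ℂ (fun x : Fin n → ℂ => x i ^ j) p :=
  (analyticAt_coord i p).pow j

theorem partialOp_pow_coord_pow {n : ℕ} {p : Fin n → ℂ} (i : Fin n) (j k : ℕ) :
    (partialOp i ^ k) (holGerm _ (analyticAt_coord_pow j p i)) =
      (j.descFactorial k : ℂ) • holGerm _ (analyticAt_coord_pow (j - k) p i) := by
  induction k with
  | zero => simp
  | succ k ih =>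
    rw [pow_succ', Module.End.mul_apply, ih, map_smul, partialOp_holGerm, Nat.descFactorial_succ]
    have e : pderiv i (fun x : Fin n → ℂ => x i ^ (j - k)) =
        fun x => ((j - k : ℕ) : ℂ) * x i ^ (j - (k + 1)) := by
      ext x
      have h1 := ((ContinuousLinearMap.proj (R := ℂ) (φ := fun _ : Fin n => ℂ) i).hasFDerivAt
        (x := x)).pow (j - k)
      have h2 := congrArg (fun L => L (Pi.single i 1)) h1.fderiv
      simp only [pderiv]
      refine h2.trans ?_
      simp [Nat.sub_sub]
    rw [Nat.cast_mul, mul_comm, mul_smul]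
    congr 1
    refine holGerm_eq_iff (hg := (analyticAt_const (v := ((j - k : ℕ) : ℂ))).smul
      (analyticAt_coord_pow (j - (k + 1)) p i)).2 ?_
    rw [e]
    rfl

theorem restrGerm_mulOp_pull {n : ℕ} {p : Fin n → ℂ} {f : (Fin n → ℂ) → ℂ} (hf : AnalyticAt ℂ f p)
    (g : HolGerm (incl p)) :
    restrGerm p (mulOp (pull f) (analyticAt_pull_incl hf) g) = mulOp f hf (restrGerm p g) := by
  have := restrGerm_liftD (mulD f hf) g
  rwa [liftD_mulD] at this

/-- The germ of `f(x₁, …, xₙ) x₀ʲ` isolates the coefficient of `∂₀ʲ`. -/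
theorem restrGerm_partialOp_pow_mulOp {n : ℕ} {p : Fin n → ℂ} {f : (Fin n → ℂ) → ℂ}
    (hf : AnalyticAt ℂ f p) (j k : ℕ) :
    restrGerm p ((partialOp 0 ^ k) (mulOp (pull f) (analyticAt_pull_incl hf)
      (holGerm _ (analyticAt_coord_pow j (incl p) 0)))) =
      if k = j then (j.factorial : ℂ) • holGerm f hf else 0 := by
  have h1 : Commute (partialOp 0 ^ k) (mulOp (pull f) (analyticAt_pull_incl hf)) :=
    Commute.pow_left (partialOp_mulOp_pull hf) k
  have h2 := LinearMap.congr_fun h1.eq (holGerm _ (analyticAt_coord_pow j (incl p) 0))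
  simp only [Module.End.mul_apply] at h2
  rw [h2, restrGerm_mulOp_pull hf, partialOp_pow_coord_pow, map_smul, map_smul, restrGerm_holGerm]
  have h0 : ((fun x : Fin (n + 1) → ℂ => x 0 ^ (j - k)) ∘ incl) =
      fun _ : Fin n → ℂ => (0 : ℂ) ^ (j - k) := by
    ext x
    simp [incl]
  rcases lt_trichotomy k j with h | rfl | h
  · rw [if_neg h.ne]
    have : holGerm _ ((analyticAt_coord_pow (j - k) (incl p) 0).comp (analyticAt_incl p)) =
        (0 : HolGerm p) := by
      refine (holGerm_eq_iff (hg := analyticAt_const (v := (0 : ℂ)))).2 ?_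
      rw [h0, zero_pow (by omega)]
    rw [this, map_zero, smul_zero]
  · rw [if_pos rfl, Nat.descFactorial_self]
    congr 1
    refine holGerm_eq_iff (hf := hf.mul ((analyticAt_coord_pow (k - k) (incl p) 0).comp
      (analyticAt_incl p))).2 ?_
    rw [h0]
    exact .of_forall fun x => by simp
  · rw [if_neg h.ne', Nat.descFactorial_of_lt h, Nat.cast_zero, zero_smul]

/-- Apply the operator to `f x₀ʲ` and restrict to `x₀ = 0`. An element of `x₀ 𝒟` gives `0`, while `∑
cₖ ∂₀ᵏ` gives `j! cⱼ f`. As `f` is arbitrary and operators are determined by their action on germs,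
`cⱼ = 0`. -/
theorem eq_zero_of_partialComb_mem {n : ℕ} {p : Fin n → ℂ} {c : ℕ →₀ DStalk p}
    (hc : partialComb p c ∈ coordIdeal p) : c = 0 := by
  obtain ⟨R, hR⟩ := hc
  ext1 j
  refine Subtype.ext (LinearMap.ext fun f => ?_)
  induction f using HolGerm.ind with
  | h f hf =>
    set G := mulOp (pull f) (analyticAt_pull_incl hf)
      (holGerm _ (analyticAt_coord_pow j (incl p) 0)) with hG
    let ev : DStalk (incl p) →+ HolGerm p :=
      { toFun := fun T => restrGerm p (T.1 G)
        map_zero' := map_zero (restrGerm p)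
        map_add' := fun S T => map_add (restrGerm p) (S.1 G) (T.1 G) }
    have h1 : ev (partialComb p c) = 0 := by
      rw [hR]
      change restrGerm p (mulOp _ (analyticAt_coord 0 (incl p)) (R.1 G)) = 0
      generalize R.1 G = G'
      induction G' using HolGerm.ind with
      | h g hg =>
        refine (holGerm_eq_iff (hf := ((analyticAt_coord 0 (incl p)).mul hg).comp
          (analyticAt_incl p)) (hg := analyticAt_const (v := (0 : ℂ)))).2 ?_
        exact .of_forall fun x => by simp [incl]
    have h2 : ∀ (k : ℕ) (S : DStalk p), ev (S • partialD 0 ^ k) =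
        if k = j then (j.factorial : ℂ) • S.1 (holGerm f hf) else 0 := by
      intro k S
      change restrGerm p ((liftD p S).1 ((partialD 0 ^ k : DStalk (incl p)).1 G)) = _
      have e : (partialD 0 ^ k : DStalk (incl p)).1 = partialOp 0 ^ k :=
        map_pow (diffOps (incl p)).val (partialD 0 : DStalk (incl p)) k
      rw [restrGerm_liftD, e, hG, restrGerm_partialOp_pow_mulOp hf]
      split_ifs
      · rw [map_smul]
      · rw [map_zero]
    rw [partialComb, Finsupp.linearCombination_apply, Finsupp.sum, map_sum,
      Finset.sum_congr rfl fun k _ => h2 k (c k), Finset.sum_ite_eq'] at h1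
    by_cases hj : j ∈ c.support
    · rw [if_pos hj] at h1
      exact (smul_eq_zero.1 h1).resolve_left (by exact_mod_cast j.factorial_ne_zero)
    · rw [Finsupp.notMem_support_iff.1 hj]
      rfl

/-- `𝒟_{ℂⁿ⁺¹} / x₀ 𝒟_{ℂⁿ⁺¹}` is free over `𝒟_{ℂⁿ}` on the powers of `∂₀`. -/
def partialCombEquiv {n : ℕ} (p : Fin n → ℂ) :
    (ℕ →₀ DStalk p) ≃ₗ[DStalk p] DStalk (incl p) ⧸ coordIdeal p :=
  LinearEquiv.ofBijective ((coordIdeal p).mkQ ∘ₗ partialComb p) (by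
    constructor
    · refine (injective_iff_map_eq_zero _).2 fun c hc => eq_zero_of_partialComb_mem ?_
      exact (Submodule.Quotient.mk_eq_zero _).1 hc
    · intro Q
      obtain ⟨P, rfl⟩ := Submodule.mkQ_surjective _ Q
      obtain ⟨c, hc⟩ := exists_sub_partialComb_mem P
      exact ⟨c, ((Submodule.Quotient.eq _).2 hc).symm⟩)

/-! ### Sections and isomorphisms of sheaves with prescribed stalks -/

theorem sheafify_map {n : ℕ} {N N' : X n → Type} {B : TopCat.PrelocalPredicate N}
    {B' : TopCat.PrelocalPredicate N'} {e : ∀ x : X n, N x → N' x}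
    (h : ∀ {U : Opens (X n)} {s : ∀ x : U, N x}, B.pred s → B'.sheafify.pred fun x => e x (s x))
    {U : Opens (X n)} {s : ∀ x : U, N x} (hs : B.sheafify.pred s) :
    B'.sheafify.pred fun x => e x (s x) :=
  B'.sheafify.locality _ fun x => by
    obtain ⟨V, hV, i, hVs⟩ := hs x
    exact ⟨V, hV, i, h hVs⟩

section ModSheaf

variable {n : ℕ} {N : X n → Type} [∀ x, AddCommGroup (N x)]
  [∀ x, Module (DStalk (x : Fin n → ℂ)) (N x)] {B : TopCat.PrelocalPredicate N}
  {F : SheafOfModules (DSheaf n)}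

/-- `F` is the sheaf of `𝒟`-modules with stalks `N` whose sections are locally given by `B`. -/
def IsModSheaf (F : SheafOfModules (DSheaf n)) (B : TopCat.PrelocalPredicate N) : Prop :=
  ∃ (h0 : ∀ U : Opens (X n), B.pred (0 : ∀ x : U, N x))
    (hadd : ∀ {U : Opens (X n)} {s t : ∀ x : U, N x}, B.pred s → B.pred t → B.pred (s + t))
    (hsmul : ∀ {U : Opens (X n)} {P : ∀ x : U, DStalk (x.1 : Fin n → ℂ)} {s : ∀ x : U, N x},
      P ∈ basicSections U → B.pred s → B.pred fun x => P x • s x),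
    F = modSheaf N B h0 @hadd @hsmul

theorem isModSheaf_modSheaf {h0 : ∀ U : Opens (X n), B.pred (0 : ∀ x : U, N x)}
    {hadd : ∀ {U : Opens (X n)} {s t : ∀ x : U, N x}, B.pred s → B.pred t → B.pred (s + t)}
    {hsmul : ∀ {U : Opens (X n)} {P : ∀ x : U, DStalk (x.1 : Fin n → ℂ)} {s : ∀ x : U, N x},
      P ∈ basicSections U → B.pred s → B.pred fun x => P x • s x} :
    IsModSheaf (modSheaf N B h0 @hadd @hsmul) B :=
  ⟨h0, @hadd, @hsmul, rfl⟩

theorem isModSheaf_hypSheaf (a : Fin n → ℤ) (β : ℂ) :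
    IsModSheaf (hypSheaf a β) (hypPrelocal a β) := by
  unfold hypSheaf
  apply isModSheaf_modSheaf

theorem isModSheaf_restrSheaf (a' : Fin (n + 1) → ℤ) (β : ℂ) :
    IsModSheaf (restrSheaf a' β) (restrPrelocal a' β) := by
  unfold restrSheaf
  apply isModSheaf_modSheaf

theorem IsModSheaf.sheafify_smul (hF : IsModSheaf F B) {U : Opens (X n)}
    {P : ∀ x : U, DStalk (x.1 : Fin n → ℂ)} (hP : P ∈ DSections U) {s : ∀ x : U, N x}
    (hs : B.sheafify.pred s) : B.sheafify.pred fun x => P x • s x := by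
  obtain ⟨h0, hadd, hsmul, -⟩ := hF
  exact (modSections N B h0 hadd hsmul U).smul_mem ⟨P, hP⟩ hs

theorem IsModSheaf.sheafify_sum (hF : IsModSheaf F B) {U : Opens (X n)}
    (c : ℕ →₀ basicSections U) {s : ℕ → ∀ x : U, N x} (hs : ∀ k, B.sheafify.pred (s k)) :
    B.sheafify.pred fun x => c.sum fun k P => P.1 x • s k x := by
  have ⟨h0, hadd, hsmul, _⟩ := hF
  have := (modSections N B h0 hadd hsmul U).sum_mem (t := c.support)
    (f := fun k x => (c k).1 x • s k x)
    fun k _ => hF.sheafify_smul (basicSections_le U (c k).2) (hs k)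
  convert! (show B.sheafify.pred _ from this) using 2 with x
  exact (Finset.sum_apply x c.support fun k (x : U) => (c k).1 x • s k x).symm

/-- `xᵢ` as a section of `𝒟` over an open set. -/
def coordSec {n : ℕ} (U : Opens (X n)) (i : Fin n) : DSections U :=
  ⟨fun _ => coordD i, basicSections_le U (Algebra.subset_adjoin
    (Or.inl ⟨fun x => x i, fun x _ => analyticAt_coord i x, rfl⟩))⟩

/-- `∂ᵢ` as a section of `𝒟` over an open set. -/
def partialSec {n : ℕ} (U : Opens (X n)) (i : Fin n) : DSections U :=
  ⟨fun _ => partialD i, basicSections_le U (Algebra.subset_adjoin (Or.inr ⟨i, rfl⟩))⟩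

theorem weylRel_sections {n : ℕ} (U : Opens (X n)) : WeylRel (coordSec U) (partialSec U) where
  comm i j := Subtype.ext (funext fun _ => commute_partialD i j)
  leibniz i j := Subtype.ext (funext fun x => by
    refine ((weylRel_DStalk (x.1 : Fin n → ℂ)).leibniz i j).trans ?_
    split_ifs <;> rfl)

/-- A family of global sections over a cofinite set of indices stable under the shifts by the `aᵢ`
extends to all indices, if `β` is not one of the missing ones. -/
theorem IsModSheaf.exists_extend_sections (hF : IsModSheaf F B) {a : Fin n → ℕ} {b : ℂ}
    {T : Set ℕ} {ψ : ℕ → ∀ x : (⊤ : Opens (X n)), N x} (hψ : ∀ j, B.sheafify.pred (ψ j))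
    (h : ∀ x : (⊤ : Opens (X n)),
      IsFamily (fun i => (coordD i : DStalk x.1)) (fun i => partialD i) a b T fun j => ψ j x)
    (ha : ∀ i, 0 < a i) (hT' : ∀ j ∈ T, ∀ i, j + a i ∈ T) {c : ℕ} (hc : ∀ j, c ≤ j → j ∈ T)
    (hb : ∀ j : ℕ, j ∉ T → b ≠ j) :
    ∃ φ : ℕ → ∀ x : (⊤ : Opens (X n)), N x, (∀ j, B.sheafify.pred (φ j)) ∧
      (∀ x : (⊤ : Opens (X n)), IsFamily (fun i => (coordD i : DStalk x.1)) (fun i => partialD i)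
        a b Set.univ fun j => φ j x) ∧ ∀ j ∈ T, φ j = ψ j := by
  obtain ⟨h0, hadd, hsmul, -⟩ := hF
  -- The extension takes place in the module of global sections over the ring of global operators;
  -- extending stalk by stalk would not show that the new members are sections.
  let Γ := modSections N B h0 hadd hsmul ⊤
  let ev : ∀ x : (⊤ : Opens (X n)), Γ →+ N x := fun x =>
    { toFun := fun s => s.1 x
      map_zero' := rfl
      map_add' := fun _ _ => rfl }
  have hev : ∀ s t : Γ, (∀ x, ev x s = ev x t) → s = t := fun s t h => Subtype.ext (funext h)
  let Ψ : ℕ → Γ := fun j => ⟨ψ j, hψ j⟩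
  have hΨ : IsFamily (coordSec ⊤) (partialSec ⊤) a b T Ψ := by
    constructor
    · exact fun j hj i => hev _ _ fun x => (h x).partial_smul j hj i
    · refine fun j hj => hev _ _ fun x => ?_
      rw [map_sum]
      refine Eq.trans (Finset.sum_congr rfl fun i _ => ?_) ((h x).euler j hj)
      exact map_nsmul (ev x) (a i) _
  obtain ⟨Φ, hΦ, hΦ'⟩ := hΨ.exists_extend (weylRel_sections ⊤) ha hT' hc hb
  refine ⟨fun j => (Φ j).1, fun j => (Φ j).2, fun x => ?_,
    fun j hj => congrArg Subtype.val (hΦ' j hj)⟩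
  constructor
  · exact fun j _ i => congrArg (ev x) (hΦ.partial_smul j trivial i)
  · intro j _
    have h1 := congrArg (ev x) (hΦ.euler j trivial)
    simp only [map_sum, map_nsmul] at h1
    exact h1

variable {N' : X n → Type} [∀ x, AddCommGroup (N' x)]
  [∀ x, Module (DStalk (x : Fin n → ℂ)) (N' x)] {B' : TopCat.PrelocalPredicate N'}
  {F' : SheafOfModules (DSheaf n)}

/-- Isomorphisms of the stalks that map sections to sections in both directions give an isomorphism
of sheaves of `𝒟`-modules. -/
theorem IsModSheaf.nonempty_iso (hF : IsModSheaf F B)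
    (hF' : IsModSheaf F' B')
    (e : ∀ x : X n, N x ≃ₗ[DStalk (x : Fin n → ℂ)] N' x)
    (h : ∀ {U : Opens (X n)} {s : ∀ x : U, N x}, B.pred s → B'.sheafify.pred fun x => e x (s x))
    (h' : ∀ {U : Opens (X n)} {s : ∀ x : U, N' x}, B'.pred s →
      B.sheafify.pred fun x => (e x).symm (s x)) : Nonempty (F ≅ F') := by
  obtain ⟨h0, hadd, hsmul, rfl⟩ := hF
  obtain ⟨h0', hadd', hsmul', rfl⟩ := hF'
  let E : ∀ U : (Opens (X n))ᵒᵖ, modSections N B h0 hadd hsmul U.unop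
      ≃ₗ[(DSheaf n).obj.obj U] modSections N' B' h0' hadd' hsmul' U.unop := fun U =>
    { toFun := fun s => ⟨fun x => e x.1 (s.1 x), sheafify_map (e := fun x => e x) h s.2⟩
      invFun := fun s => ⟨fun x => (e x.1).symm (s.1 x),
        sheafify_map (e := fun x => (e x).symm) h' s.2⟩
      map_add' := fun s t => Subtype.ext (funext fun x => map_add (e x.1) (s.1 x) (t.1 x))
      map_smul' := fun P s => Subtype.ext (funext fun x =>
        map_smul (e x.1) ((show DSections U.unop from P).1 x) (s.1 x))
      left_inv := fun s => Subtype.ext (funext fun x => (e x.1).symm_apply_apply (s.1 x))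
      right_inv := fun s => Subtype.ext (funext fun x => (e x.1).apply_symm_apply (s.1 x)) }
  let I : modPresheaf N B h0 hadd hsmul ≅ modPresheaf N' B' h0' hadd' hsmul' :=
    PresheafOfModules.isoMk (fun U => (E U).toModuleIso) (fun U V i => rfl)
  exact ⟨(SheafOfModules.fullyFaithfulForget (DSheaf n)).preimageIso I⟩

end ModSheaf

/-! ### Generators of the hypergeometric ideal -/

section Hyp

variable {n : ℕ} {a : Fin n → ℕ} {β : ℂ} {p : Fin n → ℂ}

/-- The germ at `p` of an element of the Weyl algebra. -/
def weylEval (p : Fin n → ℂ) : Weyl n →ₐ[ℂ] DStalk p :=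
  (Pi.evalAlgHom ℂ (fun p : Fin n → ℂ => DStalk p) p).comp (Weyl n).val

theorem weylEval_wdPow (k : Fin n → ℕ) : weylEval p (wdPow k) = ordPow (fun i => partialD i) k :=
  map_ordPow (weylEval p) wd k

theorem weylEval_toricOp (u : Fin n → ℤ) : weylEval p (toricOp u) =
    ordPow (fun i => partialD i) (fun i => (u i).toNat) -
      ordPow (fun i => partialD i) (fun i => (-u i).toNat) := by
  rw [toricOp, map_sub, weylEval_wdPow, weylEval_wdPow]

theorem weylEval_eulerOp : weylEval p (eulerOp (fun i => (a i : ℤ)) β) =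
    eulerSum (fun i => coordD i) (fun i => partialD i) a - algebraMap ℂ (DStalk p) β := by
  rw [eulerOp, map_sub, AlgHom.commutes, map_sum, eulerSum]
  congr 1
  refine Finset.sum_congr rfl fun i _ => ?_
  rw [map_smul, map_mul, Int.cast_natCast, Nat.cast_smul_eq_nsmul]
  rfl

/-- It is enough to test generators; the positive and negative parts of `u` are exponents of equal
degree. -/
theorem hypStalk_le {I : Submodule (DStalk p) (DStalk p)}
    (htoric : ∀ u v : Fin n → ℕ, ∑ i, u i * a i = ∑ i, v i * a i →
      ordPow (fun i => partialD i) u - ordPow (fun i => partialD i) v ∈ I)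
    (heuler : eulerSum (fun i => coordD i) (fun i => partialD i) a - algebraMap ℂ _ β ∈ I) :
    hypStalk (fun i => (a i : ℤ)) β p ≤ I := by
  refine Submodule.span_le.2 ?_
  rintro _ ⟨P, hP, rfl⟩
  change weylEval p P ∈ I
  replace hP : P ∈ hypIdeal _ β := hP
  induction hP using Submodule.span_induction with
  | mem P hP =>
    obtain ⟨u, hu, rfl⟩ | rfl := hP
    · rw [weylEval_toricOp]
      refine htoric _ _ ?_
      have : ∀ i, ((u i).toNat : ℤ) * a i - ((-u i).toNat : ℤ) * a i = a i * u i := fun i => by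
        rw [← sub_mul, mul_comm]
        congr 1
        omega
      zify
      rw [← sub_eq_zero, ← Finset.sum_sub_distrib, ← hu]
      exact Finset.sum_congr rfl fun i _ => this i
    · rw [weylEval_eulerOp]
      exact heuler
  | zero => rw [map_zero]; exact I.zero_mem
  | add P Q _ _ hP hQ => rw [map_add]; exact I.add_mem hP hQ
  | smul P Q _ hQ => rw [smul_eq_mul, map_mul]; exact I.smul_mem _ hQ

/-- The generators only involve exponents with disjoint supports. In general the common factor `∂^{u
⊓ v}` splits off on the left, which a left ideal absorbs. -/
theorem ordPow_sub_ordPow_mem_hypStalk {u v : Fin n → ℕ}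
    (h : ∑ i, u i * a i = ∑ i, v i * a i) :
    ordPow (fun i => partialD i) u - ordPow (fun i => partialD i) v ∈
      hypStalk (fun i => (a i : ℤ)) β p := by
  have hu : u = u ⊓ v + fun i => u i - v i := by
    ext i
    simp only [Pi.add_apply, Pi.inf_apply]
    omega
  have hv : v = u ⊓ v + fun i => v i - u i := by
    ext i
    simp only [Pi.add_apply, Pi.inf_apply]
    omega
  have hmem : toricOp (fun i => (u i : ℤ) - v i) ∈ hypIdeal (fun i => (a i : ℤ)) β := by
    refine Submodule.subset_span (Or.inl ⟨_, ?_, rfl⟩)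
    have h' : ∑ i, (u i : ℤ) * a i = ∑ i, (v i : ℤ) * a i := by exact_mod_cast h
    rw [← sub_eq_zero, ← Finset.sum_sub_distrib] at h'
    rw [← h']
    exact Finset.sum_congr rfl fun i _ => by ring
  have h1 : weylEval p (toricOp fun i => (u i : ℤ) - v i) ∈ hypStalk (fun i => (a i : ℤ)) β p :=
    Submodule.subset_span ⟨_, hmem, rfl⟩
  have e1 : (fun i => ((u i : ℤ) - v i).toNat) = fun i => u i - v i := by ext i; omega
  have e2 : (fun i => (-((u i : ℤ) - v i)).toNat) = fun i => v i - u i := by ext i; omega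
  rw [weylEval_toricOp, e1, e2] at h1
  have h2 := Submodule.smul_mem _ (ordPow (fun i => (partialD i : DStalk p)) (u ⊓ v)) h1
  rwa [smul_eq_mul, mul_sub, ← ordPow_add commute_partialD, ← ordPow_add commute_partialD, ← hu,
    ← hv] at h2

theorem eulerSum_sub_mem_hypStalk :
    eulerSum (fun i => coordD i) (fun i => partialD i) a - algebraMap ℂ _ β ∈
      hypStalk (fun i => (a i : ℤ)) β p := by
  rw [← weylEval_eulerOp]
  exact Submodule.subset_span ⟨_, Submodule.subset_span (Or.inr rfl), rfl⟩

/-! ### Universal properties of the stalks -/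

/-- The linear map out of the stalk of the hypergeometric module defined by a family. -/
def hypLift {M : Type*} [AddCommGroup M] [Module (DStalk p) M] {φ : ℕ → M}
    (h : IsFamily (fun i => (coordD i : DStalk p)) (fun i => partialD i) a β Set.univ φ) :
    HypMod (fun i => (a i : ℤ)) β p →ₗ[DStalk p] M :=
  (hypStalk (fun i => (a i : ℤ)) β p).liftQ (LinearMap.toSpanSingleton (DStalk p) M (φ 0)) (by
    refine hypStalk_le (fun u v huv => ?_) ?_
    · rw [LinearMap.mem_ker, LinearMap.toSpanSingleton_apply, sub_smul,
        ordPow_smul_of_shift (fun j => h.partial_smul j trivial),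
        ordPow_smul_of_shift (fun j => h.partial_smul j trivial), huv, sub_self]
    · rw [LinearMap.mem_ker, LinearMap.toSpanSingleton_apply, sub_smul,
        h.eulerSum_smul trivial, Nat.cast_zero, sub_zero, sub_self])

theorem hypLift_mk {M : Type*} [AddCommGroup M] [Module (DStalk p) M] {φ : ℕ → M}
    (h : IsFamily (fun i => (coordD i : DStalk p)) (fun i => partialD i) a β Set.univ φ)
    (P : DStalk p) : hypLift h (Submodule.Quotient.mk P) = P • φ 0 := rfl

/-- The classes of the monomials `∂ᵘ`, indexed by their degrees. -/
def monomialClass (a : Fin n → ℕ) (β : ℂ) (p : Fin n → ℂ) (j : ℕ) :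
    HypMod (fun i => (a i : ℤ)) β p :=
  Submodule.Quotient.mk
    (ordPow (fun i => partialD i) (Function.invFun (fun u : Fin n → ℕ => ∑ i, u i * a i) j))

/-- The choice made by `Function.invFun` is immaterial, as monomials of equal degree have the same
class. At a gap of the semigroup `monomialClass` is an arbitrary value that carries no relation. -/
theorem monomialClass_degree (u : Fin n → ℕ) : monomialClass a β p (∑ i, u i * a i) =
    Submodule.Quotient.mk (ordPow (fun i => partialD i) u) := by
  refine (Submodule.Quotient.eq _).2 (ordPow_sub_ordPow_mem_hypStalk ?_)
  exact Function.invFun_eq (f := fun u : Fin n → ℕ => ∑ i, u i * a i) ⟨u, rfl⟩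

theorem isFamily_monomialClass :
    IsFamily (fun i => (coordD i : DStalk p)) (fun i => partialD i) a β
      (Set.range fun u : Fin n → ℕ => ∑ i, u i * a i) (monomialClass a β p) := by
  refine (weylRel_DStalk p).isFamily_of_ordPow (v := Submodule.Quotient.mk 1) ?_ fun u => ?_
  · refine (Submodule.Quotient.eq _).2 ?_
    simp only [smul_eq_mul, mul_one]
    exact eulerSum_sub_mem_hypStalk
  · rw [monomialClass_degree, ← Submodule.Quotient.mk_smul, smul_eq_mul, mul_one]

end Hyp

/-! ### The stalk of the restriction and families over all of `ℕ` -/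

section Restr

variable {n : ℕ} {a : Fin n → ℕ} {β : ℂ} {p : Fin n → ℂ}

theorem commute_partialD_zero_pow_liftD (k : ℕ) (u : Fin n → ℕ) :
    liftD p (ordPow (fun i => partialD i) u) * partialD 0 ^ k =
      partialD 0 ^ k * ordPow (fun i => partialD i.succ) u := by
  rw [map_ordPow]
  simp only [liftD_partialD]
  exact (commute_ordPow (fun i => (commute_partialD 0 i.succ).pow_left k) u).eq.symm

theorem partialD_zero_pow_mul_ordPow (k : ℕ) (u : Fin (n + 1) → ℕ) :
    partialD 0 ^ k * ordPow (fun i => (partialD i : DStalk (incl p))) u =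
      ordPow (fun i => (partialD i : DStalk p)) (fun i : Fin n => u i.succ) •
        (partialD 0 ^ (k + u 0) : DStalk (incl p)) := by
  rw [lift_smul_def, commute_partialD_zero_pow_liftD, ordPow_succ, pow_add, mul_assoc]

theorem eulerSum_cons : eulerSum (fun i => (coordD i : DStalk (incl p))) (fun i => partialD i)
    (Fin.cons 1 a : Fin (n + 1) → ℕ) = coordD 0 * partialD 0 +
      liftD p (eulerSum (fun i => coordD i) (fun i => partialD i) a) := by
  rw [eulerSum, eulerSum, Fin.sum_univ_succ, map_sum]
  simp only [Fin.cons_zero, Fin.cons_succ, one_smul, map_nsmul, map_mul, liftD_partialD]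
  congr 1
  refine Finset.sum_congr rfl fun i _ => ?_
  rw [coordD, coordD, liftD_mulD]
  rfl

/-- Since `∂₀` has weight `1`, moving `∂₀ᵏ` to the right shifts the constant by `k`. Of the Euler
operator of `(1 a)`, only the term `x₀ ∂₀` involves index `0`, and it lands in `x₀ 𝒟`. -/
theorem partialD_zero_pow_mul_euler (k : ℕ) :
    partialD 0 ^ k * (eulerSum (fun i => (coordD i : DStalk (incl p))) (fun i => partialD i)
      (Fin.cons 1 a : Fin (n + 1) → ℕ) - algebraMap ℂ _ β) =
      coordD 0 * partialD 0 ^ (k + 1) +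
        (eulerSum (fun i => coordD i) (fun i => partialD i) a - algebraMap ℂ (DStalk p) (β - k)) •
          (partialD 0 ^ k : DStalk (incl p)) := by
  have h1 := pow_mul_of_shift
    ((weylRel_DStalk (incl p)).mul_eulerSum (a := (Fin.cons 1 a : Fin (n + 1) → ℕ)) 0) k
  rw [mul_sub, h1, ← Algebra.commutes, eulerSum_cons, lift_smul_def, map_sub, AlgHom.commutes,
    map_sub, map_natCast, pow_succ']
  simp only [Fin.cons_zero, mul_one]
  noncomm_ring

theorem mem_restrStalk_of_mem_hypStalk {a' : Fin (n + 1) → ℤ} {P : DStalk (incl p)}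
    (hP : P ∈ hypStalk a' β (incl p)) : P ∈ restrStalk a' β p :=
  ⟨P, hP, 0, by rw [mul_zero, add_zero]⟩

/-- The row `(1 a₁ … aₙ)`. -/
abbrev consRow (a : Fin n → ℕ) : Fin (n + 1) → ℤ :=
  fun i => ((Fin.cons 1 a : Fin (n + 1) → ℕ) i : ℤ)

/-- The classes of the powers of `∂₀` in the restriction. -/
def powClass (a : Fin n → ℕ) (β : ℂ) (p : Fin n → ℂ) (k : ℕ) : RestrMod (consRow a) β p :=
  Submodule.Quotient.mk (partialD 0 ^ k)

/-- The shift relation comes from `∂ᵢ ∂₀ᵏ` and `∂₀^{k+aᵢ}` having the same degree for `(1 a)`, the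
Euler relation from multiplying the Euler operator by `∂₀ᵏ` and dropping `x₀ ∂₀^{k+1}`. -/
theorem isFamily_powClass :
    IsFamily (fun i => (coordD i : DStalk p)) (fun i => partialD i) a β Set.univ
      (powClass a β p) := by
  refine .of_eulerSum (fun k _ i => ?_) (fun k _ => ?_)
  · refine (Submodule.Quotient.eq _).2 (mem_restrStalk_of_mem_hypStalk ?_)
    have h := ordPow_sub_ordPow_mem_hypStalk (a := (Fin.cons 1 a : Fin (n + 1) → ℕ)) (β := β)
      (p := incl p) (u := Pi.single i.succ 1 + Pi.single 0 k) (v := Pi.single 0 (k + a i)) (by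
        simp [Pi.single_apply, add_mul, Finset.sum_add_distrib, add_comm])
    rw [ordPow_add commute_partialD, ordPow_single, ordPow_single, ordPow_single, pow_one] at h
    change liftD p (partialD i) * partialD 0 ^ k - partialD 0 ^ (k + a i) ∈ _
    rwa [liftD_partialD]
  · refine (Submodule.Quotient.eq _).2 ?_
    refine ⟨_, Submodule.smul_mem _ (partialD 0 ^ k) (eulerSum_sub_mem_hypStalk
      (a := (Fin.cons 1 a : Fin (n + 1) → ℕ)) (β := β) (p := incl p)), -partialD 0 ^ (k + 1), ?_⟩
    rw [smul_eq_mul, partialD_zero_pow_mul_euler, sub_smul]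
    noncomm_ring

variable {M : Type*} [AddCommGroup M] [Module (DStalk p) M]

/-- The linear map `𝒟_{ℂⁿ⁺¹,(0,p)} → M` that kills `x₀ 𝒟` and maps `∂₀ᵏ` to `ψₖ`. -/
def partialCombLift (ψ : ℕ → M) : DStalk (incl p) →ₗ[DStalk p] M :=
  Finsupp.linearCombination (DStalk p) ψ ∘ₗ (partialCombEquiv p).symm.toLinearMap ∘ₗ
    (coordIdeal p).mkQ

theorem partialCombLift_of_mem (ψ : ℕ → M) {P : DStalk (incl p)} (hP : P ∈ coordIdeal p) :
    partialCombLift ψ P = 0 := by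
  have : (coordIdeal p).mkQ P = 0 := (Submodule.Quotient.mk_eq_zero _).2 hP
  simp only [partialCombLift, LinearMap.comp_apply, this, map_zero]

theorem partialCombLift_partialComb (ψ : ℕ → M) (c : ℕ →₀ DStalk p) :
    partialCombLift ψ (partialComb p c) = Finsupp.linearCombination (DStalk p) ψ c :=
  congrArg (Finsupp.linearCombination (DStalk p) ψ) ((partialCombEquiv p).symm_apply_apply c)

theorem partialCombLift_pow (ψ : ℕ → M) (k : ℕ) :
    partialCombLift (p := p) ψ (partialD 0 ^ k) = ψ k := by
  have := partialCombLift_partialComb ψ (Finsupp.single k (1 : DStalk p))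
  rwa [partialComb, Finsupp.linearCombination_single, Finsupp.linearCombination_single, one_smul,
    one_smul] at this

/-- `partialCombLift` is linear only over operators on `ℂⁿ`, whereas left ideals on `ℂⁿ⁺¹` involve
all left multiples of `h`. Writing `P` as `∑ Pₖ ∂₀ᵏ` modulo `x₀ 𝒟` reduces these to the multiples
`∂₀ᵏ h`. -/
theorem partialCombLift_mul_eq_zero {ψ : ℕ → M} {h : DStalk (incl p)}
    (hh : ∀ k : ℕ, partialCombLift ψ (partialD 0 ^ k * h) = 0) (P : DStalk (incl p)) :
    partialCombLift ψ (P * h) = 0 := by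
  obtain ⟨c, hc⟩ := exists_sub_partialComb_mem P
  have e : P * h = (P - partialComb p c) * h + partialComb p c * h := by
    rw [← add_mul, sub_add_cancel]
  rw [e, map_add, partialCombLift_of_mem ψ (mul_mem_coordIdeal hc h), zero_add, partialComb,
    Finsupp.linearCombination_apply, Finsupp.sum, Finset.sum_mul, map_sum]
  refine Finset.sum_eq_zero fun k _ => ?_
  rw [lift_smul_def, mul_assoc, ← lift_smul_def, map_smul, hh, smul_zero]

/-- The linear map out of the stalk of the restriction defined by a family. -/
def restrLift {ψ : ℕ → M}
    (h : IsFamily (fun i => (coordD i : DStalk p)) (fun i => partialD i) a β Set.univ ψ) :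
    RestrMod (consRow a) β p →ₗ[DStalk p] M :=
  (restrStalk (consRow a) β p).liftQ (partialCombLift ψ) (by
    -- `I` is the largest left ideal contained in the kernel, so only generators of the
    -- hypergeometric ideal need to be tested.
    let I : Submodule (DStalk (incl p)) (DStalk (incl p)) :=
      { carrier := {Q | ∀ P, partialCombLift ψ (P * Q) = 0}
        zero_mem' := fun P => by rw [mul_zero, map_zero]
        add_mem' := fun hQ hQ' P => by rw [mul_add, map_add, hQ, hQ', add_zero]
        smul_mem' := fun R Q hQ P => by rw [smul_eq_mul, ← mul_assoc, hQ] }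
    have hI : hypStalk (consRow a) β (incl p) ≤ I := by
      refine hypStalk_le (fun u v huv => partialCombLift_mul_eq_zero fun k => ?_)
        (partialCombLift_mul_eq_zero fun k => ?_)
      · rw [Fin.sum_univ_succ, Fin.sum_univ_succ] at huv
        simp only [Fin.cons_zero, Fin.cons_succ, mul_one] at huv
        rw [mul_sub, partialD_zero_pow_mul_ordPow, partialD_zero_pow_mul_ordPow, map_sub, map_smul,
          map_smul, partialCombLift_pow, partialCombLift_pow,
          ordPow_smul_of_shift (fun j => h.partial_smul j trivial),
          ordPow_smul_of_shift (fun j => h.partial_smul j trivial), add_assoc, add_assoc, huv,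
          sub_self]
      · rw [partialD_zero_pow_mul_euler, map_add, partialCombLift_of_mem ψ ⟨_, rfl⟩, zero_add,
          map_smul, partialCombLift_pow, sub_smul, h.eulerSum_smul trivial, sub_self]
    rintro _ ⟨Q, hQ, R, rfl⟩
    have := hI hQ 1
    rw [one_mul] at this
    rw [LinearMap.mem_ker, map_add, this, partialCombLift_of_mem ψ ⟨_, rfl⟩, add_zero])

theorem restrLift_mk {ψ : ℕ → M}
    (h : IsFamily (fun i => (coordD i : DStalk p)) (fun i => partialD i) a β Set.univ ψ)
    (P : DStalk (incl p)) : restrLift h (Submodule.Quotient.mk P) = partialCombLift ψ P := rfl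

theorem restrLift_powClass {ψ : ℕ → M}
    (h : IsFamily (fun i => (coordD i : DStalk p)) (fun i => partialD i) a β Set.univ ψ) (k : ℕ) :
    restrLift h (powClass a β p k) = ψ k :=
  partialCombLift_pow ψ k

theorem restrMod_hom_ext {f g : RestrMod (consRow a) β p →ₗ[DStalk p] M}
    (h : ∀ k, f (powClass a β p k) = g (powClass a β p k)) : f = g := by
  refine Submodule.linearMap_qext _ (LinearMap.ext fun P => ?_)
  obtain ⟨c, R, hc⟩ := exists_sub_partialComb_mem P
  have e : (Submodule.Quotient.mk P : RestrMod (consRow a) β p) =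
      Finsupp.linearCombination (DStalk p) (powClass a β p) c := by
    have h1 : (restrStalk (consRow a) β p).mkQ P =
        (restrStalk (consRow a) β p).mkQ (partialComb p c) :=
      (Submodule.Quotient.eq _).2 ⟨0, Submodule.zero_mem _, R, by rw [hc, zero_add]⟩
    refine h1.trans ?_
    rw [partialComb, Finsupp.linearCombination_apply, Finsupp.linearCombination_apply, Finsupp.sum,
      map_sum]
    rfl
  change f (Submodule.Quotient.mk P) = g (Submodule.Quotient.mk P)
  rw [e, Finsupp.linearCombination_apply, Finsupp.sum, map_sum, map_sum]
  exact Finset.sum_congr rfl fun k _ => by rw [map_smul, map_smul, h]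

end Restr

/-! ### The restriction of a hypergeometric module -/

section Main

variable {n : ℕ} {a : Fin n → ℕ} {β : ℂ}

theorem hypPrelocal_pred_monomialClass (U : Opens (X n)) (j : ℕ) :
    (hypPrelocal (fun i => (a i : ℤ)) β).pred fun x : U => monomialClass a β x.1 j := by
  let u := Function.invFun (fun u : Fin n → ℕ => ∑ i, u i * a i) j
  refine ⟨_, (ordPow (partialSec U) u).2, fun x => ?_⟩
  refine congrArg Submodule.Quotient.mk ?_
  exact (map_ordPow ((Pi.evalAlgHom ℂ (fun x : U => DStalk (x.1 : Fin n → ℂ)) x).comp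
    (DSections U).val) (partialSec U) u).symm

theorem restrPrelocal_pred_powClass (U : Opens (X n)) (k : ℕ) :
    (restrPrelocal (consRow a) β).pred fun x : U => powClass a β x.1 k :=
  ⟨⊤, _, (partialSec ⊤ 0 ^ k).2, fun _ _ => trivial, fun _ => rfl⟩

theorem hypPrelocal_pred_hypLift {U : Opens (X n)} {N : X n → Type} [∀ x, AddCommGroup (N x)]
    [∀ x, Module (DStalk (x : Fin n → ℂ)) (N x)] {B : TopCat.PrelocalPredicate N}
    (hB : ∀ {U : Opens (X n)} {P : ∀ x : U, DStalk (x.1 : Fin n → ℂ)} {s : ∀ x : U, N x},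
      P ∈ DSections U → B.sheafify.pred s → B.sheafify.pred fun x => P x • s x)
    {φ : ℕ → ∀ x : X n, N x}
    (h : ∀ x, IsFamily (fun i => (coordD i : DStalk x)) (fun i => partialD i) a β Set.univ
      fun j => φ j x)
    (hφ : B.sheafify.pred fun x : (⊤ : Opens (X n)) => φ 0 x.1)
    {s : ∀ x : U, HypMod (fun i => (a i : ℤ)) β x.1}
    (hs : (hypPrelocal (fun i => (a i : ℤ)) β).pred s) :
    B.sheafify.pred fun x : U => hypLift (h x.1) (s x) := by
  obtain ⟨P, hP, hs⟩ := hs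
  have := hB hP (B.sheafify.res (homOfLE le_top : U ⟶ ⊤) _ hφ)
  convert this using 2 with x
  rw [hs]
  rfl

theorem restrPrelocal_pred_restrLift {U : Opens (X n)} {N : X n → Type} [∀ x, AddCommGroup (N x)]
    [∀ x, Module (DStalk (x : Fin n → ℂ)) (N x)] {B : TopCat.PrelocalPredicate N}
    (hB : ∀ {U : Opens (X n)} (c : ℕ →₀ basicSections U) {s : ℕ → ∀ x : U, N x},
      (∀ k, B.sheafify.pred (s k)) → B.sheafify.pred fun x => c.sum fun k P => P.1 x • s k x)
    {ψ : ℕ → ∀ x : X n, N x}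
    (h : ∀ x, IsFamily (fun i => (coordD i : DStalk x)) (fun i => partialD i) a β Set.univ
      fun j => ψ j x)
    (hψ : ∀ j, B.sheafify.pred fun x : (⊤ : Opens (X n)) => ψ j x.1)
    {s : ∀ x : U, RestrMod (consRow a) β x.1} (hs : (restrPrelocal (consRow a) β).pred s) :
    B.sheafify.pred fun x : U => restrLift (h x.1) (s x) := by
  obtain ⟨W, P, hP, hW, hs⟩ := hs
  -- Near each point `P` is `∑ Pₖ ∂₀ᵏ` modulo `x₀ 𝒟` with coefficients that are sections, so the
  -- image is the section `∑ Pₖ ψₖ`.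
  refine B.sheafify.locality _ fun x₀ => ?_
  obtain ⟨V, hV, i, hVP⟩ := hP ⟨incl x₀.1, hW x₀.1 x₀.2⟩
  let U' : Opens (X n) := U ⊓ ⟨{x | incl x ∈ V}, V.2.preimage continuous_incl⟩
  refine ⟨U', ⟨x₀.2, hV⟩, homOfLE inf_le_left, ?_⟩
  obtain ⟨c, hc⟩ := exists_finsupp_of_mem_decompSections
    (basicSections_mem_decompSections (U := U') (fun x hx => hx.2) hVP)
  have := hB c fun k => B.sheafify.res (homOfLE le_top : U' ⟶ ⊤) _ (hψ k)
  convert this using 2 with x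
  have h1 := partialCombLift_of_mem (fun j => ψ j x.1) (hc x)
  rw [map_sub, sub_eq_zero] at h1
  rw [hs, restrLift_mk]
  refine h1.trans ?_
  rw [Finsupp.sum, map_sum]
  exact Finset.sum_congr rfl fun k _ => by rw [map_smul, partialCombLift_pow]; rfl

/-- The restriction of `ℳ_{(1 a)}(β)` is `ℳ_a(β + m)`, if `β` is none of `-1, …, -m` and
`β + m` is not a gap of the semigroup generated by the `aᵢ`. -/
theorem nonempty_restrSheaf_iso (ha : ∀ i, 0 < a i) (m : ℕ) (hm : ∀ j : ℕ, j < m → β + m ≠ j)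
    {c : ℕ} (hc : ∀ j, c ≤ j → j ∈ Set.range fun u : Fin n → ℕ => ∑ i, u i * a i)
    (hS : ∀ j : ℕ, (j ∉ Set.range fun u : Fin n → ℕ => ∑ i, u i * a i) → β + m ≠ j) :
    Nonempty (restrSheaf (consRow a) β ≅ hypSheaf (fun i => (a i : ℤ)) (β + m)) := by
  have hm' : ∀ j : ℕ, j ∉ Set.Ici m → β + m ≠ j := fun j hj => hm j (not_le.1 hj)
  -- In the restriction, the classes of `∂₀ᵏ` are placed at the indices `k + m` and extended down to
  -- `0`.
  obtain ⟨φ', hφpred, hφ, hφT⟩ := (isModSheaf_restrSheaf (consRow a) β).exists_extend_sections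
    (ψ := fun j x => powClass a β x.1 (j - m))
    (fun j => TopCat.PrelocalPredicate.sheafifyOf (restrPrelocal_pred_powClass ⊤ _))
    (fun x => isFamily_powClass.shift_right m) ha
    (fun j hj i => le_trans (Set.mem_Ici.1 hj) (Nat.le_add_right _ _)) (c := m) (fun j hj => hj) hm'
  -- In the hypergeometric module, the monomial classes are extended from the semigroup to its gaps.
  obtain ⟨ψ', hψpred, hψ, hψT⟩ :=
    (isModSheaf_hypSheaf (fun i => (a i : ℤ)) (β + m)).exists_extend_sections
    (ψ := fun j x => monomialClass a (β + m) x.1 j)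
    (fun j => TopCat.PrelocalPredicate.sheafifyOf (hypPrelocal_pred_monomialClass ⊤ _))
    (fun x => isFamily_monomialClass) ha
    (by
      rintro _ ⟨u, rfl⟩ i
      exact ⟨u + Pi.single i 1, by simp [add_mul, Finset.sum_add_distrib, Pi.single_apply]⟩) hc hS
  let φ : ℕ → ∀ x : X n, RestrMod (consRow a) β x := fun j x => φ' j ⟨x, trivial⟩
  let ψ : ℕ → ∀ x : X n, HypMod (fun i => (a i : ℤ)) (β + m) x := fun j x => ψ' j ⟨x, trivial⟩
  have hφ1 : ∀ x : X n, IsFamily (fun i => (coordD i : DStalk x)) (fun i => partialD i) a (β + m)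
      Set.univ fun j => φ j x := fun x => hφ ⟨x, trivial⟩
  have hψ1 : ∀ x : X n, IsFamily (fun i => (coordD i : DStalk x)) (fun i => partialD i) a (β + m)
      Set.univ fun j => ψ j x := fun x => hψ ⟨x, trivial⟩
  have hφ2 : ∀ x k, φ (k + m) x = powClass a β x k := fun x k => by
    have := congrFun (hφT (k + m) (Nat.le_add_left m k)) ⟨x, trivial⟩
    rwa [Nat.add_sub_cancel] at this
  have hψ2 : ∀ x (u : Fin n → ℕ), ψ (∑ i, u i * a i) x =
      Submodule.Quotient.mk (ordPow (fun i => partialD i) u) := fun x u => by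
    rw [← monomialClass_degree]
    exact congrFun (hψT _ ⟨u, rfl⟩) ⟨x, trivial⟩
  -- `f` maps the class of `1` to `φ₀`, and `g` maps the class of `∂₀ᵏ` to `ψ_{k+m}`.
  let f := fun x : X n => hypLift (hφ1 x)
  let g := fun x : X n => restrLift (hψ1 x).shift_left
  have hgf : ∀ x, g x ∘ₗ f x = LinearMap.id := fun x => by
    -- The families `g φⱼ` and `ψⱼ` agree for `j ≥ m`, hence everywhere; index `0` yields `g (f 1) =
    -- 1`.
    have h1 := IsFamily.ext ((hφ1 x).map (g x)) (hψ1 x) ha (T := Set.Ici m) (c := m)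
      (fun j hj => hj) hm' (fun j hj => by
        obtain ⟨k, rfl⟩ := Nat.exists_eq_add_of_le' (Set.mem_Ici.1 hj)
        rw [hφ2]
        exact restrLift_powClass _ k) 0
    have h2 : ψ 0 x = Submodule.Quotient.mk 1 := by
      have := hψ2 x 0
      simpa [ordPow] using this
    refine Submodule.linearMap_qext _ (LinearMap.ext fun P => ?_)
    change g x (P • φ 0 x) = Submodule.Quotient.mk P
    rw [map_smul, h1, h2, ← Submodule.Quotient.mk_smul, smul_eq_mul, mul_one]
  have hfg : ∀ x, f x ∘ₗ g x = LinearMap.id := fun x => by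
    -- The families `f ψⱼ` and `φⱼ` agree on the semigroup, where both are `∂ᵘ φ₀`, hence
    -- everywhere; the indices `k + m` give the generators `∂₀ᵏ`.
    have h1 := IsFamily.ext ((hψ1 x).map (f x)) (hφ1 x) ha hc hS (by
      rintro _ ⟨u, rfl⟩
      rw [hψ2]
      refine (hypLift_mk (hφ1 x) _).trans ?_
      rw [ordPow_smul_of_shift (fun j => (hφ1 x).partial_smul j trivial), zero_add])
    refine restrMod_hom_ext fun k => ?_
    have h2 : g x (powClass a β x k) = ψ (k + m) x := restrLift_powClass _ k
    rw [LinearMap.comp_apply, h2, h1, hφ2]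
    rfl
  refine (isModSheaf_restrSheaf (consRow a) β).nonempty_iso
    (isModSheaf_hypSheaf (fun i => (a i : ℤ)) (β + m))
    (fun x => LinearEquiv.ofLinearMap (g x) (f x) (hgf x) (hfg x)) ?_ ?_
  · intro U s hs
    exact restrPrelocal_pred_restrLift
      (isModSheaf_hypSheaf (fun i => (a i : ℤ)) (β + m)).sheafify_sum
      (ψ := fun j => ψ (j + m)) (fun x => (hψ1 x).shift_left) (fun j => hψpred (j + m)) hs
  · intro U s hs
    exact hypPrelocal_pred_hypLift
      (fun hP hs => (isModSheaf_restrSheaf (consRow a) β).sheafify_smul hP hs)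
      hφ1 (hφpred 0) hs

/-- The semigroup generated by coprime numbers contains all large numbers. -/
theorem exists_forall_ge_mem_range_degree (hgcd : Finset.univ.gcd (fun i => (a i : ℤ)) = 1) :
    ∃ c, ∀ j, c ≤ j → j ∈ Set.range fun u : Fin n → ℕ => ∑ i, u i * a i := by
  have h1 : Nat.setGcd (Set.range a) = 1 := by
    have : ((Nat.setGcd (Set.range a) : ℕ) : ℤ) ∣ 1 := by
      rw [← hgcd]
      exact Finset.dvd_gcd fun i _ => Int.natCast_dvd_natCast.2 (Nat.setGcd_dvd_of_mem ⟨i, rfl⟩)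
    exact Nat.dvd_one.1 (by exact_mod_cast this)
  obtain ⟨c, hc⟩ := Nat.exists_mem_closure_of_ge (Set.range a)
  refine ⟨c, fun j hj => ?_⟩
  have h2 := hc j hj (h1 ▸ one_dvd j)
  clear hc
  clear hj
  induction h2 using AddSubmonoid.closure_induction with
  | mem x hx =>
    obtain ⟨i, rfl⟩ := hx
    exact ⟨Pi.single i 1, by simp [Pi.single_apply]⟩
  | zero => exact ⟨0, by simp⟩
  | add x y _ _ hx hy =>
    obtain ⟨u, rfl⟩ := hx
    obtain ⟨v, rfl⟩ := hy
    exact ⟨u + v, by simp [add_mul, Finset.sum_add_distrib]⟩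

end Main

end HolD

end

/-! ### The choice of `β'` -/

theorem mainTheorem5 (n : ℕ) (a : Fin n → ℤ) (ha : StrictMono a) (ha1 : ∀ i, 1 < a i)
    (hgcd : Finset.univ.gcd a = 1) :
    ∃ b : ℂ → ℂ,
      (∀ β : ℂ, Nonempty
        (HolD.restrSheaf (Fin.cons 1 a : Fin (n + 1) → ℤ) β ≅ HolD.hypSheaf a (b β))) ∧
      {β : ℂ | b β ≠ β}.Finite := by
  classical
  lift a to Fin n → ℕ using fun i => (zero_lt_one.trans (ha1 i)).le
  have hpos : ∀ i, 0 < a i := fun i => by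
    have : (1 : ℤ) < a i := ha1 i
    omega
  have hrow : (Fin.cons 1 (fun i => (a i : ℤ)) : Fin (n + 1) → ℤ) = HolD.consRow a := by
    ext i
    refine Fin.cases ?_ (fun i => ?_) i <;> simp [HolD.consRow]
  obtain ⟨c, hc⟩ := HolD.exists_forall_ge_mem_range_degree hgcd
  let S : Set ℕ := Set.range fun u : Fin n → ℕ => ∑ i, u i * a i
  let G : Set ℂ := (fun j : ℕ => (j : ℂ)) '' Sᶜ
  have hG : G.Finite := Set.Finite.image _ ((Set.finite_Iio c).subset fun j hj =>
    not_le.1 fun h => hj (hc j h))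
  -- All integers `≥ c` lie in the semigroup. For a gap `β = k` the value `k + c` is therefore not a
  -- gap, and it is not among `0, …, c - 1`, so the shift by `m = c` is allowed. Otherwise `m = 0`
  -- works.
  refine ⟨fun β => if β ∈ G then β + c else β, fun β => ?_, hG.subset fun β hβ => ?_⟩
  · rw [hrow]
    by_cases hβ : β ∈ G
    · simp only [if_pos hβ]
      obtain ⟨k, -, rfl⟩ := hβ
      refine HolD.nonempty_restrSheaf_iso hpos c (fun j hj h => ?_) hc (fun j hj h => ?_)
      · have : k + c = j := by exact_mod_cast (show (k : ℂ) + c = j from h)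
        omega
      · have : k + c = j := by exact_mod_cast (show (k : ℂ) + c = j from h)
        exact hj (hc j (by omega))
    · simp only [if_neg hβ]
      have := HolD.nonempty_restrSheaf_iso (β := β) hpos 0
        (fun j hj => absurd hj (Nat.not_lt_zero j)) hc
        (fun j hj h => hβ ⟨j, hj, by simpa using h.symm⟩)
      rwa [Nat.cast_zero, add_zero] at this
  · by_contra h
    exact hβ (if_neg h)
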